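/- **Setting.** Let $k\in\mathbb N$, let $\Gamma\in\mathbb R^{k\times k}$ be symmetric positive definite, and let $0<\mu_{\min}\le 1$ be a lower bound on the smallest eigenvalue of $\Gamma$. Let $C\ge 1$, $\beta\ge 1$, $p\in(0,1)$ with $p<1/\beta$, and let $\boldsymbol b=(b_j)_{j\ge1}\in\ell^p(\mathbb N)$ be a sequence of nonnegative numbers. Let $\Xi$ be a set of designs. For every $s\in\mathbb N$ let $G_s\colon[-1,1]^s\times\Xi\to\mathbb R^k$ be a forward model that is infinitely differentiable in its first argument and satisfies, in the Euclidean norm, $$\|\partial^{\boldsymbol\nu}_{\boldsymbol\theta}G_s(\boldsymbol\theta,\boldsymbol\xi)\|\le C\,(|\boldsymbol\nu|!)^\beta\,\boldsymbol b^{\boldsymbol\nu}\qquad\text{for all }\boldsymbol\theta\in[-1,1]^s,\ \boldsymbol\nu\in\mathbb N_0^s,\ \boldsymbol\xi\in\Xi,$$ where $\boldsymbol b^{\boldsymbol\nu}=\prod_{j=1}^s b_j^{\nu_j}$, $|\boldsymbol\nu|=\sum_j\nu_j$ and $0^0=1$; the constants $C,\beta$ and the sequence $\boldsymbol b$ do not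 depend on $s$ or $\boldsymbol\xi$. Put $\Theta_s=[-\frac12,\frac12]^s$, $G_{s,\rm per}(\boldsymbol\theta,\boldsymbol\xi)=G_s(\sin(2\pi\boldsymbol\theta),\boldsymbol\xi)$ (sine taken componentwise), $\|\boldsymbol x\|_{\Gamma^{-1}}=\sqrt{\boldsymbol x^{\rm T}\Gamma^{-1}\boldsymbol x}$ and $$f_{\rm per}(\boldsymbol\theta,\boldsymbol y)=\frac{1}{(\det(2\pi\Gamma))^{1/2}}\,{\rm e}^{-\frac12\|\boldsymbol y-G_{s,\rm per}(\boldsymbol\theta,\boldsymbol\xi)\|^2_{\Gamma^{-1}}},\qquad I_s(f_{\rm per})=\int_{\Theta_s}f_{\rm per}(\boldsymbol\theta,\boldsymbol y)\,{\rm d}\boldsymbol\theta .$$ The function $f_{\rm per}$ is $1$-periodic in each component of $\boldsymbol\theta\in\mathbb R^s$. For $n\in\mathbb N$ and a generating vector $\boldsymbol z\in\mathbb N^s$, the unshifted rank-1 lattice rule is $$Q_{s,n}(f_{\rm per})=\frac1n\sum_{i=1}^n f_{\rm per}\Big(\Big\{\frac{i\boldsymbol z}{n}\Big\},\boldsymbol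 y\Big),$$ where $\{\cdot\}$ is the componentwise fractional part. **Weights.** Let $\alpha=\lfloor 1/p\rfloor+1$, let $S(\cdot,\cdot)$ be the Stirling numbers of the second kind, and for $\mathfrak u\subseteq\{1,\dots,s\}$ let the SPOD (smoothness-driven product and order dependent) weights be $$\gamma_{\mathfrak u}=\sum_{\boldsymbol m_{\mathfrak u}\in\{1,\dots,\alpha\}^{|\mathfrak u|}}C^{|\boldsymbol m_{\mathfrak u}|}\,2^{\beta(|\boldsymbol m_{\mathfrak u}|-1)}\,\mu_{\min}^{-|\boldsymbol m_{\mathfrak u}|/2}\,(|\boldsymbol m_{\mathfrak u}|!)^\beta\prod_{j\in\mathfrak u}\big(b_j^{m_j}S(\alpha,m_j)\big).$$ **CBC algorithm.** For $\boldsymbol h\in\mathbb Z^d$ let ${\rm supp}(\boldsymbol h)=\{j:h_j\neq0\}$. The worst-case error of the $d$-dimensional lattice rule generated by $(z_1,\dots,z_d)$, in the unit ball of the Korobov space with norm $\sup_{\boldsymbol h}|\widehat F(\boldsymbol h)|\,\gamma_{{\rm supp}(\boldsymbol h)}^{-1}\prod_{j\in{\rm supp}(\boldsymbol h)}|h_j|^\alpha$,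 is $$e_{n,d}(z_1,\dots,z_d)=\sum_{\substack{\boldsymbol h\in\mathbb Z^d\setminus\{\boldsymbol 0\}\\ \boldsymbol h\cdot(z_1,\dots,z_d)\equiv0\ ({\rm mod}\ n)}}\gamma_{{\rm supp}(\boldsymbol h)}\prod_{j\in{\rm supp}(\boldsymbol h)}|h_j|^{-\alpha}.$$ The component-by-component (CBC) algorithm chooses successively, for $d=1,\dots,s$ and with $z_1,\dots,z_{d-1}$ held fixed, a minimizer $z_d$ of $e_{n,d}(z_1,\dots,z_{d-1},z_d)$ over all $z_d\in\{1,\dots,n\}$ with $\gcd(z_d,n)=1$; ties are broken arbitrarily. **Theorem.** There is a constant $K>0$, independent of the dimension $s$ and of $n$, $\boldsymbol y$ and $\boldsymbol\xi$, such that for all $s\in\mathbb N$ and all $n=2^m$, $m\ge0$, the CBC algorithm with the weights $\gamma_{\mathfrak u}$ and smoothness $\alpha$ as inputs yields a generating vector $\boldsymbol z\in\mathbb N^s$, and every generating vector that it can yield satisfies $$|I_s(f_{\rm per})-Q_{s,n}(f_{\rm per})|\le K\,n^{-1/p}\qquad\text{for all }\boldsymbol y\in\mathbb R^k\text{ and }\boldsymbol\xi\in\Xi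 .$$ -/

import Mathlib

open scoped ContDiff

namespace PeriodicOED

noncomputable section

/-- The cube `[-1,1]^s`, the range of `θ ↦ (sin (2πθ₁), …, sin (2πθ_s))`. -/
def paramBox (s : ℕ) : Set (Fin s → ℝ) := Set.Icc (fun _ => -1) (fun _ => 1)

/-- The parameter domain `Θ_s = [-1/2,1/2]^s`. -/
def Theta (s : ℕ) : Set (Fin s → ℝ) := Set.Icc (fun _ => -(1 / 2)) (fun _ => 1 / 2)

/-- The mixed partial derivative `∂^ν f(θ)` relative to the set `S`: the derivative of order
`|ν| = ∑ j, ν j` of `f` within `S` applied to the list of directions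
`e₁, …, e₁, e₂, …, e₂, …`, in which `e_j` occurs exactly `ν j` times. -/
def mixedPartial {s : ℕ} {E : Type*} [NormedAddCommGroup E] [NormedSpace ℝ E]
    (S : Set (Fin s → ℝ)) (f : (Fin s → ℝ) → E) (ν : Fin s → ℕ) (θ : Fin s → ℝ) : E :=
  iteratedFDerivWithin ℝ (∑ j, ν j) f S θ
    (fun l => Pi.single (finSigmaFinEquiv.symm l).1 (1 : ℝ))

/-- The parametric (Gevrey) regularity bound for a sequence of forward models `G_s`, uniform in
the dimension `s`, the parameter and the design: `G_s` is smooth in the parameter and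
`‖∂^ν G_s(θ,ξ)‖ ≤ C (|ν|!)^β b^ν`, with the Euclidean norm on `ℝ^k`. -/
def ParametricRegularity {k : ℕ} {Ξ : Type*}
    (G : (s : ℕ) → (Fin s → ℝ) → Ξ → EuclideanSpace ℝ (Fin k))
    (C β : ℝ) (b : ℕ → ℝ) : Prop :=
  ∀ s : ℕ, 1 ≤ s → ∀ ξ : Ξ,
    ContDiffOn ℝ ∞ (fun θ => G s θ ξ) (paramBox s) ∧
    ∀ θ ∈ paramBox s, ∀ ν : Fin s → ℕ,
      ‖mixedPartial (paramBox s) (fun θ' => G s θ' ξ) ν θ‖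
        ≤ C * ((∑ j, ν j).factorial : ℝ) ^ β * ∏ j : Fin s, b (j : ℕ) ^ ν j

/-- The periodically reparameterized forward model `G_{s,per}(θ) = G_s(sin (2πθ))`. -/
def periodize {s : ℕ} {E : Type*} (g : (Fin s → ℝ) → E) (θ : Fin s → ℝ) : E :=
  g (fun j => Real.sin (2 * Real.pi * θ j))

/-- `‖x‖_{Γ⁻¹} = √(xᵀ Γ⁻¹ x)`. -/
def precNorm {k : ℕ} (Γ : Matrix (Fin k) (Fin k) ℝ) (x : EuclideanSpace ℝ (Fin k)) : ℝ :=
  Real.sqrt (x.ofLp ⬝ᵥ (Γ⁻¹.mulVec x.ofLp))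

/-- The Gaussian normalization `C_{k,Γ} = (det (2πΓ))^{-1/2}`. -/
def gaussConst {k : ℕ} (Γ : Matrix (Fin k) (Fin k) ℝ) : ℝ :=
  1 / Real.sqrt ((2 * Real.pi) • Γ).det

/-- The inner integrand `f_per(θ,y) = C_{k,Γ} exp(-½ ‖y - G_{s,per}(θ,ξ)‖²_{Γ⁻¹})` for the forward
model `g = G_s(·,ξ)`. -/
def fPer {s k : ℕ} (Γ : Matrix (Fin k) (Fin k) ℝ) (g : (Fin s → ℝ) → EuclideanSpace ℝ (Fin k))
    (y : EuclideanSpace ℝ (Fin k)) (θ : Fin s → ℝ) : ℝ :=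
  gaussConst Γ * Real.exp (-(1 / 2) * precNorm Γ (y - periodize g θ) ^ 2)

/-- The lattice point `t_i = {i z / n}` (componentwise fractional part). -/
def latticePoint {s : ℕ} (n : ℕ) (z : Fin s → ℕ) (i : ℕ) : Fin s → ℝ :=
  fun j => Int.fract ((i : ℝ) * (z j : ℝ) / (n : ℝ))

/-- The unshifted rank-1 lattice rule `Q_{s,n}(F) = (1/n) ∑_{i=1}^n F(t_i)`. -/
def latticeRule {s : ℕ} (n : ℕ) (z : Fin s → ℕ) (F : (Fin s → ℝ) → ℝ) : ℝ :=
  (1 / (n : ℝ)) * ∑ i ∈ Finset.Icc 1 n, F (latticePoint n z i)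

/-- The SPOD weight
`γ_u = ∑_{m ∈ {1:α}^u} C^{|m|} 2^{β(|m|-1)} μ^{-|m|/2} (|m|!)^β ∏_{j∈u} b_j^{m_j} S(α,m_j)`,
with `S` the Stirling numbers of the second kind. -/
def spodWeight (C β μ : ℝ) (b : ℕ → ℝ) (α : ℕ) {s : ℕ} (u : Finset (Fin s)) : ℝ :=
  ∑ m ∈ Fintype.piFinset (fun _ : u => Finset.Icc 1 α),
    C ^ (∑ j, m j) * (2 : ℝ) ^ (β * (((∑ j, m j : ℕ) : ℝ) - 1))
      * μ ^ (-(((∑ j, m j : ℕ) : ℝ) / 2)) * ((∑ j, m j).factorial : ℝ) ^ β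
      * ∏ j : u, (b (j : Fin s) ^ m j * (Nat.stirlingSecond α (m j) : ℝ))

/-- The support of a frequency `h ∈ ℤ^s`. -/
def freqSupp {s : ℕ} (h : Fin s → ℤ) : Finset (Fin s) := Finset.univ.filter (fun j => h j ≠ 0)

/-- The reciprocal `1 / r_α(γ,h) = γ_{supp h} ∏_{j ∈ supp h} |h_j|^{-α}` of the Korobov weight
`r_α(γ,h) = γ_{supp h}⁻¹ ∏_{j ∈ supp h} |h_j|^α`. -/
def korobovCoeff {s : ℕ} (γ : Finset (Fin s) → ℝ) (α : ℕ) (h : Fin s → ℤ) : ℝ :=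
  γ (freqSupp h) * ∏ j ∈ freqSupp h, (|(h j : ℝ)| ^ α)⁻¹

/-- The worst-case error `∑_{0 ≠ h ∈ ℤ^d, h·z ≡ 0 mod n} 1 / r_α(γ,h)` of the `d`-dimensional
lattice rule generated by the components of `z` up to and including the one at position `d`, in
the unit ball of the weighted Korobov space with norm `sup_h |F̂(h)| r_α(γ,h)`.
Frequencies in the leading components are written as `h ∈ ℤ^s` vanishing after position `d`. -/
def cbcError {s : ℕ} (n : ℕ) (γ : Finset (Fin s) → ℝ) (α : ℕ) (d : Fin s) (z : Fin s → ℕ) : ℝ :=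
  ∑' h : {h : Fin s → ℤ // h ≠ 0 ∧ (∀ j, d < j → h j = 0) ∧
      (n : ℤ) ∣ ∑ j, h j * (z j : ℤ)}, korobovCoeff γ α h.1

/-- The candidates for the components of a generating vector: the representatives in
`{1, …, n}` of the units modulo `n`. -/
def cbcCandidates (n : ℕ) : Finset ℕ := (Finset.Icc 1 n).filter (fun w => Nat.Coprime w n)

/-- `z` is an output of the component-by-component algorithm with `n` points, weights `γ` and
smoothness `α`: for `d = 1, …, s`, with the previous components held fixed, `z_d` is a minimizer
of the worst-case error of the `d`-dimensional rule over all candidates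
(ties may be broken in any way). -/
def IsCBCVector {s : ℕ} (n : ℕ) (γ : Finset (Fin s) → ℝ) (α : ℕ) (z : Fin s → ℕ) : Prop :=
  ∀ d : Fin s, z d ∈ cbcCandidates n ∧
    ∀ w ∈ cbcCandidates n, cbcError n γ α d z ≤ cbcError n γ α d (Function.update z d w)

end

end PeriodicOED

open PeriodicOED

/-! A lattice rule integrates exp(2πi h·θ) exactly for every nonzero h outside the dual lattice h·z
≡ 0 (mod n), so its error is at most the sum of the Fourier coefficients |f̂(h)| over nonzero dual h
(`abs_integral_sub_latticeRule_le`). Two facts then suffice: |f̂(h)| is at most a constant times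
γ_{supp h} ∏ |h_j|^{-α}, and the CBC construction makes the dual sum of these bounds O(n^{-1/p}),
both uniformly in s, y and ξ.

Fourier decay comes from α derivatives in each variable of supp h
(`norm_torusCoeff_le_korobovCoeff`). After a linear change of variables the likelihood is a standard
Gaussian composed with the forward model. Gaussian derivatives of order l are O(l!), and Faà di
Bruno's formula preserves the Gevrey class: summing (number of blocks)! ∏ (block size)! over all set
partitions of N points gives 2^{N-1} N!, the source of 2^{β(|m|-1)} in the weights
(`norm_iteratedFDerivWithin_comp_gevrey`). The substitution θ ↦ sin(2πθ) brings in the Stirling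
numbers S(α,m_j) and a power of 2π (`abs_iteratedDeriv_trigCoeff_le`), and that power cancels the
one produced by differentiating exponentials. The SPOD weights collect exactly these factors.

For the CBC part, let E be the dual sum. Since (∑ a)^p ≤ ∑ a^p, and a minimizer is no worse than the
mean over all candidates, counting solutions of a linear congruence bounds #candidates · E^p by ∑_u
γ_u^p c^{|u|} (`card_mul_dualSum_rpow_le`). Here αp > 1 makes ∑ |k|^{-αp} converge. For n = 2^m the
gcd factors are harmless and at least half of all residues are candidates, so E ≤ (2M/n)^{1/p} for
any bound M of the weight sum. Such an M exists independently of s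
(`exists_bound_sum_spodWeight_rpow`): by the multinomial theorem and ∑ b_j^p < ∞, the sum is
dominated by ∑_l (l!)^{βp-1} Y^l, which converges because βp < 1. -/

/-! ### Factorial bounds for the derivatives of a Gaussian. -/

section GaussianDerivatives

variable {E : Type*} [NormedAddCommGroup E]

/-- The function `w ↦ exp (-‖w‖² / 2)`. -/
noncomputable def stdGauss (w : E) : ℝ := Real.exp (-(1 / 2) * ‖w‖ ^ 2)

lemma stdGauss_pos (w : E) : 0 < stdGauss w := Real.exp_pos _

variable [InnerProductSpace ℝ E]

lemma contDiff_stdGauss : ContDiff ℝ ∞ (stdGauss : E → ℝ) := by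
  unfold stdGauss
  exact (contDiff_const.mul (contDiff_norm_sq ℝ)).exp

lemma fderiv_stdGauss (w : E) : fderiv ℝ stdGauss w = stdGauss w • (-(innerSL ℝ w)) := by
  have h1 : HasFDerivAt (fun w : E => -(1 / 2) * ‖w‖ ^ 2) ((-(1 / 2) : ℝ) • (2 • innerSL ℝ w)) w :=
    ((hasStrictFDerivAt_norm_sq w).hasFDerivAt).const_mul _
  have h2 := h1.exp
  rw [show (stdGauss : E → ℝ) = fun w => Real.exp (-(1 / 2) * ‖w‖ ^ 2) from rfl, h2.fderiv]
  ext v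
  simp

lemma norm_iteratedFDeriv_clm_le {F : Type*} [NormedAddCommGroup F] [NormedSpace ℝ F]
    (L : E →L[ℝ] F) (i : ℕ) (w : E) :
    ‖iteratedFDeriv ℝ i L w‖ ≤ if i = 0 then ‖L w‖ else if i = 1 then ‖L‖ else 0 := by
  match i with
  | 0 => simp
  | 1 => simp [← norm_iteratedFDeriv_fderiv]
  | i + 2 =>
    have h : fderiv ℝ L = fun _ => L := by ext1 x; exact L.fderiv
    rw [← norm_iteratedFDeriv_fderiv, h, iteratedFDeriv_const_of_ne (by omega)]
    simp

/-- The gradient is the Gaussian times a linear map of w, so only two terms of Leibniz' rule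
survive. This is the Hermite recurrence in norm form; for l = 0 the truncated index l - 1 is
harmless because its coefficient vanishes. -/
lemma norm_iteratedFDeriv_stdGauss_succ_le (l : ℕ) (w : E) :
    ‖iteratedFDeriv ℝ (l + 1) stdGauss w‖ ≤ ‖w‖ * ‖iteratedFDeriv ℝ l stdGauss w‖
      + l * ‖iteratedFDeriv ℝ (l - 1) stdGauss w‖ := by
  have hf : fderiv ℝ (stdGauss : E → ℝ) = fun w => stdGauss w • ((-(innerSL ℝ : E →L[ℝ] _)) w) := by
    ext1 w
    rw [fderiv_stdGauss]; simp
  rw [← norm_iteratedFDeriv_fderiv, hf]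
  refine (norm_iteratedFDeriv_smul_le (N := ∞) contDiff_stdGauss
    (ContinuousLinearMap.contDiff _) w (mod_cast le_top)).trans ?_
  have hb : ∀ i, ‖iteratedFDeriv ℝ i (-(innerSL ℝ : E →L[ℝ] _)) w‖ ≤
      if i = 0 then ‖w‖ else if i = 1 then 1 else 0 := by
    intro i
    refine (norm_iteratedFDeriv_clm_le _ i w).trans ?_
    split_ifs
    · rw [neg_apply, norm_neg]; exact (innerSL_apply_norm ℝ w).le
    · rw [norm_neg]; exact norm_innerSL_le _
    · rfl
  rcases l with _ | l
  · simp only [zero_add, Finset.range_one, Finset.sum_singleton, Nat.choose_self, Nat.cast_one,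
      one_mul, Nat.cast_zero, zero_mul, add_zero]
    rw [mul_comm]
    exact mul_le_mul_of_nonneg_right (hb 0) (norm_nonneg _)
  · rw [Finset.sum_range_succ, Finset.sum_range_succ, Finset.sum_eq_zero, zero_add]
    · have h0 := hb 0
      have h1 := hb 1
      simp only [if_true, one_ne_zero, if_false] at h0 h1
      have e1 : l + 1 - (l + 1) = 0 := by omega
      have e2 : l + 1 - l = 1 := by omega
      rw [e1, e2]
      simp only [Nat.choose_self, Nat.cast_one, one_mul, Nat.choose_succ_self_right]
      rw [add_comm]
      refine add_le_add ?_ ?_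
      · rw [mul_comm]; gcongr
      · refine mul_le_of_le_one_right (by positivity) h1
    · intro i hi
      rw [Finset.mem_range] at hi
      have h2 := hb (l + 1 - i)
      rw [if_neg (by omega), if_neg (by omega)] at h2
      rw [le_antisymm h2 (norm_nonneg _), mul_zero]

/-- The two-term recurrence closes on this form because a(a + r) + r² ≤ (a + r)² for a, r ≥ 0. -/
lemma norm_iteratedFDeriv_stdGauss_le (l : ℕ) (w : E) :
    ‖iteratedFDeriv ℝ l stdGauss w‖ ≤ (‖w‖ + √l) ^ l * stdGauss w := by
  induction l using Nat.strong_induction_on with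
  | _ l ih =>
  rcases l with _ | l
  · simp [abs_of_pos (stdGauss_pos w)]
  refine (norm_iteratedFDeriv_stdGauss_succ_le l w).trans ?_
  have hg := (stdGauss_pos w).le
  have hmono : √(l : ℝ) ≤ √((l + 1 : ℕ) : ℝ) := Real.sqrt_le_sqrt (by push_cast; linarith)
  rcases l with _ | l
  · have := ih 0 (by omega)
    simp at this ⊢
    nlinarith [norm_nonneg w]
  · have h1 := ih (l + 1) (by omega)
    have h0 := ih l (by omega)
    have hmono0 : √(l : ℝ) ≤ √((l + 1 : ℕ) : ℝ) := Real.sqrt_le_sqrt (by push_cast; linarith)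
    set r := √((l + 1 : ℕ) : ℝ) with hr
    have hr2 : ((l + 1 : ℕ) : ℝ) = r ^ 2 := by rw [hr, Real.sq_sqrt (by positivity)]
    have hr0 : 0 ≤ r := Real.sqrt_nonneg _
    calc ‖w‖ * ‖iteratedFDeriv ℝ (l + 1) stdGauss w‖
          + ((l + 1 : ℕ) : ℝ) * ‖iteratedFDeriv ℝ (l + 1 - 1) stdGauss w‖
        ≤ ‖w‖ * ((‖w‖ + r) ^ (l + 1) * stdGauss w)
          + r ^ 2 * ((‖w‖ + r) ^ l * stdGauss w) := by
          rw [hr2]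
          gcongr
          refine h0.trans ?_
          gcongr
      _ = (‖w‖ + r) ^ l * (‖w‖ * (‖w‖ + r) + r ^ 2) * stdGauss w := by ring
      _ ≤ (‖w‖ + r) ^ l * ((‖w‖ + r) ^ 2) * stdGauss w := by
          gcongr
          nlinarith [norm_nonneg w]
      _ = (‖w‖ + r) ^ (l + 1 + 1) * stdGauss w := by ring
      _ ≤ _ := by gcongr

/-- The derivatives of `exp (-‖w‖² / 2)` of order `l` are bounded by a constant times `l!`. -/
lemma norm_iteratedFDeriv_stdGauss_le_factorial (l : ℕ) (w : E) :
    ‖iteratedFDeriv ℝ l stdGauss w‖ ≤ Real.exp 7 * l.factorial := by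
  refine (norm_iteratedFDeriv_stdGauss_le l w).trans ?_
  -- The scale 3 pays for the geometric factor: x^l carries 3^l, which absorbs e^l. What remains is
  -- 3a - a²/2 + 3r - r² ≤ 9/2 + 9/4 < 7 for a = ‖w‖ and r = √l, whence the constant e^7.
  set x := 3 * (‖w‖ + √l) with hx
  have hx0 : 0 ≤ x := by positivity
  have h1 : x ^ l ≤ l.factorial * Real.exp x := by
    have := Real.pow_div_factorial_le_exp x hx0 l
    rwa [div_le_iff₀ (by positivity), mul_comm] at this
  have h3 : Real.exp l ≤ 3 ^ l := by
    rw [← Real.exp_one_pow]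
    exact pow_le_pow_left₀ (Real.exp_pos _).le Real.exp_one_lt_three.le _
  have h4 : Real.exp x * stdGauss w ≤ Real.exp 7 * 3 ^ l := by
    refine le_trans ?_ (mul_le_mul_of_nonneg_left h3 (Real.exp_pos _).le)
    rw [stdGauss, ← Real.exp_add, ← Real.exp_add]
    apply Real.exp_le_exp.mpr
    have := Real.sq_sqrt (Nat.cast_nonneg (α := ℝ) l)
    nlinarith [sq_nonneg (‖w‖ - 3), sq_nonneg (√(l : ℝ) - 3 / 2)]
  have h5 : (3 : ℝ) ^ l * ((‖w‖ + √l) ^ l * stdGauss w) ≤ 3 ^ l * (Real.exp 7 * l.factorial) := by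
    calc (3 : ℝ) ^ l * ((‖w‖ + √l) ^ l * stdGauss w) = x ^ l * stdGauss w := by
          rw [hx, mul_pow]; ring
      _ ≤ l.factorial * Real.exp x * stdGauss w := by
          gcongr; exact (stdGauss_pos w).le
      _ = l.factorial * (Real.exp x * stdGauss w) := by ring
      _ ≤ l.factorial * (Real.exp 7 * 3 ^ l) := by gcongr
      _ = _ := by ring
  exact le_of_mul_le_mul_left h5 (by positivity)

end GaussianDerivatives

/-! ### Reduction of the precision norm to the Euclidean norm. -/

section PrecisionNorm

open Matrix

variable {k : ℕ}

lemma posDef_quadForm_ge {Γ : Matrix (Fin k) (Fin k) ℝ} (hΓ : Γ.PosDef) {μ : ℝ}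
    (hμ : ∀ i, μ ≤ hΓ.1.eigenvalues i) (z : Fin k → ℝ) :
    μ * (z ⬝ᵥ z) ≤ z ⬝ᵥ (Γ *ᵥ z) := by
  have h : (Γ - μ • (1 : Matrix (Fin k) (Fin k) ℝ)).PosSemidef := by
    have hH : (Γ - μ • (1 : Matrix (Fin k) (Fin k) ℝ)).IsHermitian := by
      refine hΓ.1.sub ?_
      simp [Matrix.IsHermitian]
    rw [hH.posSemidef_iff_eigenvalues_nonneg]
    intro i
    have hi := hH.eigenvalues_mem_spectrum_real i
    generalize hH.eigenvalues i = e at hi ⊢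
    rw [← Algebra.algebraMap_eq_smul_one, sub_eq_neg_add, ← spectrum.add_mem_iff,
      hΓ.1.spectrum_real_eq_range_eigenvalues] at hi
    obtain ⟨j, hj⟩ := hi
    have := hμ j
    simp only [Pi.zero_apply]
    linarith
  have h2 := h.dotProduct_mulVec_nonneg z
  simp only [sub_mulVec, smul_mulVec, one_mulVec, dotProduct_sub, dotProduct_smul, star_trivial,
    smul_eq_mul] at h2
  linarith

/-- The precision norm is a Euclidean norm after a linear map of norm at most `μ^{-1/2}`. -/
lemma exists_precNorm_eq_norm {Γ : Matrix (Fin k) (Fin k) ℝ} (hΓ : Γ.PosDef) {μ : ℝ} (hμ0 : 0 < μ)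
    (hμ : ∀ i, μ ≤ hΓ.1.eigenvalues i) :
    ∃ B : EuclideanSpace ℝ (Fin k) →L[ℝ] EuclideanSpace ℝ (Fin k),
      (∀ x, precNorm Γ x ^ 2 = ‖B x‖ ^ 2) ∧ ∀ x, ‖B x‖ ≤ μ ^ (-(1 / 2) : ℝ) * ‖x‖ := by
  obtain ⟨B, hB⟩ : ∃ B : Matrix (Fin k) (Fin k) ℝ, Γ⁻¹ = Bᵀ * B := by
    open scoped MatrixOrder in
    have h := CFC.sqrt_mul_sqrt_self Γ⁻¹ hΓ.inv.posSemidef.nonneg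
    have h2 := (CFC.sqrt_nonneg Γ⁻¹).posSemidef.1
    exact ⟨_, by rw [← h, ← conjTranspose_eq_transpose_of_trivial, h2.eq, h]⟩
  have hnsq : ∀ x : EuclideanSpace ℝ (Fin k), ‖x‖ ^ 2 = x.ofLp ⬝ᵥ x.ofLp := by
    intro x
    rw [EuclideanSpace.norm_sq_eq]
    simp [dotProduct, sq]
  have hBx : ∀ x : EuclideanSpace ℝ (Fin k),
      ‖Matrix.toEuclideanCLM (𝕜 := ℝ) B x‖ ^ 2 = x.ofLp ⬝ᵥ (Γ⁻¹ *ᵥ x.ofLp) := by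
    intro x
    rw [hnsq, Matrix.ofLp_toEuclideanCLM, hB, ← mulVec_mulVec, dotProduct_mulVec _ Bᵀ, vecMul_transpose]
  refine ⟨Matrix.toEuclideanCLM (𝕜 := ℝ) B, fun x => ?_, fun x => ?_⟩
  · rw [hBx, precNorm, Real.sq_sqrt]
    rw [← hBx]; positivity
  -- With t = z·x = ‖Bx‖², the eigenvalue bound gives μ z·z ≤ t and Cauchy–Schwarz gives t² ≤
  -- (z·z)‖x‖². Hence μt ≤ ‖x‖², without diagonalizing the inverse.
  · set z := Γ⁻¹ *ᵥ x.ofLp with hz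
    have hx : Γ *ᵥ z = x.ofLp := by
      rw [hz, mulVec_mulVec, mul_nonsing_inv _ (by simpa using hΓ.det_pos.ne'), one_mulVec]
    have h1 := posDef_quadForm_ge hΓ hμ z
    rw [hx] at h1
    have h2 := hBx x
    have h3 : x.ofLp ⬝ᵥ z = z ⬝ᵥ x.ofLp := dotProduct_comm _ _
    have h4 : (z ⬝ᵥ x.ofLp) ^ 2 ≤ (z ⬝ᵥ z) * (x.ofLp ⬝ᵥ x.ofLp) := by
      simp only [dotProduct, ← sq]
      exact Finset.sum_mul_sq_le_sq_mul_sq _ _ _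
    rw [← hz, h3] at h2
    rw [← hnsq x] at h4
    have h5 : μ * ‖Matrix.toEuclideanCLM (𝕜 := ℝ) B x‖ ^ 2 ≤ ‖x‖ ^ 2 := by
      rw [h2]
      set t := z ⬝ᵥ x.ofLp
      have ht : 0 ≤ t := by rw [← h2]; positivity
      rcases ht.eq_or_lt with h0 | h0
      · rw [← h0]; simp
      · refine le_of_mul_le_mul_left ?_ h0
        nlinarith [mul_le_mul_of_nonneg_right h1 (sq_nonneg ‖x‖)]
    refine abs_le_of_sq_le_sq' ?_ (by positivity) |>.2
    rw [mul_pow, ← Real.rpow_natCast (μ ^ _), ← Real.rpow_mul hμ0.le]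
    norm_num
    rw [Real.rpow_neg_one, ← div_eq_inv_mul, le_div_iff₀ hμ0]
    linarith

end PrecisionNorm

/-! ### Faà di Bruno's formula and Gevrey bounds for compositions. -/

section FaaDiBruno

lemma sum_rpow_le_rpow_sum {ι : Type*} (s : Finset ι) (a : ι → ℝ) (ha : ∀ i ∈ s, 0 ≤ a i) {β : ℝ}
    (hβ : 1 ≤ β) : ∑ i ∈ s, a i ^ β ≤ (∑ i ∈ s, a i) ^ β := by
  classical
  induction s using Finset.induction_on with
  | empty => simp [Real.zero_rpow (by linarith : β ≠ 0)]
  | insert i s hi ih =>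
    rw [Finset.sum_insert hi, Finset.sum_insert hi]
    refine (add_le_add_right (ih fun j hj => ha j (Finset.mem_insert_of_mem hj)) _).trans ?_
    exact Real.add_rpow_le_rpow_add (ha i (Finset.mem_insert_self _ _))
      (Finset.sum_nonneg fun j hj => ha j (Finset.mem_insert_of_mem hj)) hβ

/-- The product of the factorials of the block sizes of an ordered partition. -/
def OrderedFinpartition.prodFactorial {n : ℕ} (c : OrderedFinpartition n) : ℝ :=
  ∏ i, ((c.partSize i).factorial : ℝ)

lemma OrderedFinpartition.sum_partSize {n : ℕ} (c : OrderedFinpartition n) :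
    ∑ i, c.partSize i = n := by
  have h := Fintype.card_congr c.equivSigma
  simpa using h

lemma OrderedFinpartition.prodFactorial_extendLeft {n : ℕ} (c : OrderedFinpartition n) :
    c.extendLeft.prodFactorial = c.prodFactorial := by
  rw [prodFactorial, prodFactorial]
  simp only [extendLeft_partSize]
  exact (Fin.prod_univ_succ (n := c.length) _).trans (by simp)

lemma OrderedFinpartition.prodFactorial_extendMiddle {n : ℕ} (c : OrderedFinpartition n)
    (k : Fin c.length) :
    (c.extendMiddle k).prodFactorial = (c.partSize k + 1) * c.prodFactorial := by
  rw [prodFactorial, prodFactorial]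
  simp only [extendMiddle_partSize]
  have : ∀ i : Fin c.length,
      ((Function.update c.partSize k (c.partSize k + 1) i).factorial : ℝ)
        = Function.update (fun i => ((c.partSize i).factorial : ℝ)) k
          ((c.partSize k + 1).factorial : ℝ) i := by
    intro i
    rcases eq_or_ne i k with rfl | h
    · simp
    · simp [h]
  refine (Finset.prod_congr (s₂ := (Finset.univ : Finset (Fin c.length))) rfl
    fun i _ => this i).trans ?_
  rw [Finset.prod_update_of_mem (Finset.mem_univ k),
    ← Finset.mul_prod_erase _ _ (Finset.mem_univ k), ← Finset.sdiff_singleton_eq_erase]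
  rw [Nat.factorial_succ]; push_cast; ring

/-- A new point either forms its own block or joins a block of size q, multiplying the factorial
product by q + 1. Summed over the blocks, the factors q + 1 give n plus the number of blocks. -/
lemma OrderedFinpartition.sum_length_succ (n : ℕ) (φ : ℕ → ℝ) :
    ∑ c : OrderedFinpartition (n + 1), φ c.length * c.prodFactorial
      = ∑ c : OrderedFinpartition n,
        (φ (c.length + 1) + (n + c.length) * φ c.length) * c.prodFactorial := by
  rw [← (extendEquiv n).sum_comp, Fintype.sum_sigma]
  refine Finset.sum_congr rfl fun c _ => ?_
  rw [Fintype.sum_option]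
  simp only [extendEquiv_apply, extend_none, extend_some, prodFactorial_extendLeft,
    prodFactorial_extendMiddle, extendLeft_length, extendMiddle_length]
  rw [← Finset.mul_sum, ← Finset.sum_mul, Finset.sum_add_distrib]
  have : (∑ i, (c.partSize i : ℝ)) = n := by exact_mod_cast c.sum_partSize
  simp [this]
  ring

/-- The number of ordered partitions into `j + 1` blocks, weighted by the factorials of the block
sizes, is a Lah number. -/
lemma OrderedFinpartition.sum_length_eq (N : ℕ) (φ : ℕ → ℝ) :
    ∑ c : OrderedFinpartition (N + 1), φ c.length * c.prodFactorial
      = ∑ j ∈ Finset.range (N + 1),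
        φ (j + 1) * (((N + 1).factorial : ℝ) / (j + 1).factorial * N.choose j) := by
  induction N generalizing φ with
  | zero =>
    rw [sum_length_succ]
    simp [prodFactorial]
  | succ N ih =>
    rw [sum_length_succ, ih (fun l => φ (l + 1) + ((N + 1 : ℕ) + l) * φ l)]
    -- These are the Lah numbers L(N+1, j+1). The next two facts are their recurrence L(n+1,k) =
    -- L(n,k-1) + (n+k) L(n,k), which matches the extension step for partitions.
    set A : ℕ → ℕ → ℝ := fun N j => ((N + 1).factorial : ℝ) / (j + 1).factorial * N.choose j
      with hA
    have hA0 : A (N + 1) 0 = (N + 2) * A N 0 := by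
      simp only [hA, Nat.factorial_succ (N + 1)]; push_cast; field_simp; simp; ring
    have hA1 : ∀ j, A (N + 1) (j + 1) = A N j + (N + j + 3) * A N (j + 1) := by
      intro j
      have h1 : ((N.choose (j + 1) : ℕ) : ℝ) * (j + 1) = N.choose j * (N - j) := by
        rcases le_or_gt j N with h | h
        · have := Nat.choose_succ_right_eq N j
          rw [← Nat.cast_sub h]
          exact_mod_cast this
        · simp [Nat.choose_eq_zero_of_lt h, Nat.choose_eq_zero_of_lt (h.trans (Nat.lt_succ_self j))]
      simp only [hA, Nat.choose_succ_succ, Nat.factorial_succ]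
      push_cast
      field_simp
      linear_combination (-1 : ℝ) * h1
    have hAN : A N (N + 1) = 0 := by simp [hA]
    change ∑ j ∈ Finset.range (N + 1), _ * A N j = ∑ j ∈ Finset.range (N + 2), φ (j + 1) * A (N + 1) j
    have h3 : ∑ j ∈ Finset.range (N + 1), (N + j + 2) * φ (j + 1) * A N j
        = ∑ j ∈ Finset.range (N + 1), (N + j + 3) * φ (j + 2) * A N (j + 1)
          + (N + 2) * φ 1 * A N 0 := by
      have h4 := Finset.sum_range_succ' (fun j : ℕ => (N + j + 2) * φ (j + 1) * A N j) (N + 1)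
      rw [Finset.sum_range_succ, hAN, mul_zero, add_zero] at h4
      rw [h4]
      congr 1
      · refine Finset.sum_congr rfl fun j _ => ?_
        push_cast; ring
      · simp
    have hL : ∑ j ∈ Finset.range (N + 1),
        (φ (j + 1 + 1) + (((N + 1 : ℕ) : ℝ) + ((j + 1 : ℕ) : ℝ)) * φ (j + 1)) * A N j
        = ∑ j ∈ Finset.range (N + 1), φ (j + 2) * A N j
          + ∑ j ∈ Finset.range (N + 1), (N + j + 2) * φ (j + 1) * A N j := by
      rw [← Finset.sum_add_distrib]
      exact Finset.sum_congr rfl fun j _ => by push_cast; ring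
    have hR : ∑ j ∈ Finset.range (N + 1), φ (j + 1 + 1) * A (N + 1) (j + 1)
        = ∑ j ∈ Finset.range (N + 1), φ (j + 2) * A N j
          + ∑ j ∈ Finset.range (N + 1), (N + j + 3) * φ (j + 2) * A N (j + 1) := by
      rw [← Finset.sum_add_distrib]
      exact Finset.sum_congr rfl fun j _ => by rw [hA1]; ring
    rw [Finset.sum_range_succ' _ (N + 1), hR, hL, h3, hA0, zero_add]
    ring

/-- The weight (j+1)! cancels the denominator of the Lah number, leaving (N+1)! times a full row of
binomial coefficients. -/
lemma OrderedFinpartition.sum_factorial (N : ℕ) :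
    ∑ c : OrderedFinpartition (N + 1), (c.length.factorial : ℝ) * c.prodFactorial
      = 2 ^ N * (N + 1).factorial := by
  rw [sum_length_eq N (fun l => (l.factorial : ℝ))]
  have h := Nat.sum_range_choose N
  have h2 : ∑ j ∈ Finset.range (N + 1), (N.choose j : ℝ) = 2 ^ N := by exact_mod_cast h
  rw [← h2, Finset.sum_mul]
  refine Finset.sum_congr rfl fun j _ => ?_
  have : ((j + 1).factorial : ℝ) ≠ 0 := by positivity
  field_simp

variable {E F H : Type*} [NormedAddCommGroup E] [NormedSpace ℝ E] [NormedAddCommGroup F]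
  [NormedSpace ℝ F] [NormedAddCommGroup H] [NormedSpace ℝ H]

/-- A Gevrey bound for a composition with an outer function whose derivatives of order `l` are
bounded by a multiple of `l!`. -/
lemma norm_iteratedFDerivWithin_comp_gevrey {S : Set E} (hS : UniqueDiffOn ℝ S) {f : E → F}
    {g : F → H} (hf : ContDiffOn ℝ ∞ f S) (hg : ContDiff ℝ ∞ g) {A D β : ℝ} (hA : 0 ≤ A)
    (hgA : ∀ l y, ‖iteratedFDeriv ℝ l g y‖ ≤ A * l.factorial) (hD : 1 ≤ D) (hβ : 1 ≤ β)
    {x : E} (hx : x ∈ S) (N : ℕ) (v : Fin (N + 1) → E) (b : Fin (N + 1) → ℝ) (hb : ∀ i, 0 ≤ b i)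
    (hfb : ∀ (m : ℕ) (u : Fin m → Fin (N + 1)), 0 < m →
      ‖iteratedFDerivWithin ℝ m f S x (v ∘ u)‖ ≤ D * (m.factorial : ℝ) ^ β * ∏ i, b (u i)) :
    ‖iteratedFDerivWithin ℝ (N + 1) (g ∘ f) S x v‖
      ≤ A * D ^ (N + 1) * (2 ^ N * (N + 1).factorial : ℝ) ^ β * ∏ i, b i := by
  have hcomp := (contDiffOn_univ.2 hg).ftaylorSeriesWithin uniqueDiffOn_univ |>.comp
    (hf.ftaylorSeriesWithin hS) (Set.mapsTo_univ f S)
  have h1 := hcomp.eq_iteratedFDerivWithin_of_uniqueDiffOn (m := N + 1) (mod_cast le_top) hS hx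
  have hD0 : 0 ≤ D := by linarith
  rw [← h1, FormalMultilinearSeries.taylorComp, sum_apply]
  refine (norm_sum_le _ _).trans ?_
  have hterm : ∀ c : OrderedFinpartition (N + 1),
      ‖(ftaylorSeriesWithin ℝ g Set.univ (f x)).compAlongOrderedFinpartition
        (ftaylorSeriesWithin ℝ f S x) c v‖
      ≤ A * D ^ (N + 1) * (∏ i, b i) * (c.length.factorial * c.prodFactorial) ^ β := by
    intro c
    rw [FormalMultilinearSeries.compAlongOrderedFinpartition_apply]
    refine (ContinuousMultilinearMap.le_opNorm _ _).trans ?_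
    -- Weakening l! to (l!)^β puts the outer and inner factorials under one β-th power.
    -- Superadditivity of t ↦ t^β then moves the sum over partitions inside, where it is known
    -- exactly.
    have hl : ‖ftaylorSeriesWithin ℝ g Set.univ (f x) c.length‖
        ≤ A * (c.length.factorial : ℝ) ^ β := by
      rw [ftaylorSeriesWithin, iteratedFDerivWithin_univ]
      refine (hgA _ _).trans ?_
      gcongr
      exact Real.self_le_rpow_of_one_le (mod_cast c.length.factorial_pos) hβ
    have hp : ∏ i, ‖c.applyOrderedFinpartition
          (fun m => ftaylorSeriesWithin ℝ f S x (c.partSize m)) v i‖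
        ≤ ∏ i, (D * ((c.partSize i).factorial : ℝ) ^ β * ∏ j, b (c.emb i j)) := by
      refine Finset.prod_le_prod (fun i _ => norm_nonneg _) fun i _ => ?_
      exact hfb _ _ (c.partSize_pos i)
    have hp2 : ∏ i, (D * ((c.partSize i).factorial : ℝ) ^ β * ∏ j, b (c.emb i j))
        = D ^ c.length * c.prodFactorial ^ β * ∏ i, b i := by
      rw [Finset.prod_mul_distrib, Finset.prod_mul_distrib, c.prod_sigma_eq_prod]
      rw [OrderedFinpartition.prodFactorial, Real.finsetProd_rpow _ _ (fun i _ => by positivity)]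
      simp
    have hDl : D ^ c.length ≤ D ^ (N + 1) := pow_le_pow_right₀ hD c.length_le
    have hP : 0 ≤ ∏ i, b i := Finset.prod_nonneg fun i _ => hb i
    have hpf : 0 ≤ c.prodFactorial := Finset.prod_nonneg fun i _ => by positivity
    calc _ ≤ A * (c.length.factorial : ℝ) ^ β * (D ^ c.length * c.prodFactorial ^ β * ∏ i, b i) := by
          rw [← hp2]
          exact mul_le_mul hl hp (Finset.prod_nonneg fun i _ => norm_nonneg _) (by positivity)
      _ ≤ A * (c.length.factorial : ℝ) ^ β * (D ^ (N + 1) * c.prodFactorial ^ β * ∏ i, b i) := by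
          gcongr
      _ = _ := by
          rw [Real.mul_rpow (by positivity) hpf]; ring
  refine (Finset.sum_le_sum fun c _ => hterm c).trans ?_
  rw [← Finset.mul_sum]
  have hsum := sum_rpow_le_rpow_sum Finset.univ
    (fun c : OrderedFinpartition (N + 1) => (c.length.factorial : ℝ) * c.prodFactorial)
    (fun c _ => mul_nonneg (by positivity) (Finset.prod_nonneg fun i _ => by positivity)) hβ
  rw [OrderedFinpartition.sum_factorial] at hsum
  have hP : 0 ≤ ∏ i, b i := Finset.prod_nonneg fun i _ => hb i
  calc _ ≤ A * D ^ (N + 1) * (∏ i, b i) * (2 ^ N * (N + 1).factorial : ℝ) ^ β := by gcongr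
    _ = _ := by ring

end FaaDiBruno

/-! ### Mixed partial derivatives in arbitrary order. -/

section ListPartial

variable {s : ℕ} {E : Type*} [NormedAddCommGroup E] [NormedSpace ℝ E]

/-- The iterated partial derivative of `f` within `S` in the coordinate directions of a list. -/
noncomputable def listPartial (S : Set (Fin s → ℝ)) (f : (Fin s → ℝ) → E) :
    List (Fin s) → (Fin s → ℝ) → E
  | [] => f
  | j :: l => fun x => fderivWithin ℝ (listPartial S f l) S x (Pi.single j 1)

variable {S : Set (Fin s → ℝ)} {f : (Fin s → ℝ) → E}

lemma contDiffOn_listPartial (hS : UniqueDiffOn ℝ S) (hf : ContDiffOn ℝ ∞ f S) (l : List (Fin s)) :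
    ContDiffOn ℝ ∞ (listPartial S f l) S := by
  induction l with
  | nil => exact hf
  | cons j l ih => exact (ih.fderivWithin hS (by simp)).clm_apply contDiffOn_const

lemma iteratedFDerivWithin_eq_listPartial (hS : UniqueDiffOn ℝ S) (hf : ContDiffOn ℝ ∞ f S)
    {n : ℕ} (v : Fin n → Fin s) {x : Fin s → ℝ} (hx : x ∈ S) :
    iteratedFDerivWithin ℝ n f S x (fun i => Pi.single (v i) (1 : ℝ))
      = listPartial S f (List.ofFn v) x := by
  induction n generalizing x with
  | zero => simp [listPartial]
  | succ n ih =>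
    rw [iteratedFDerivWithin_succ_apply_left, List.ofFn_succ, listPartial]
    have h1 : Set.EqOn (listPartial S f (List.ofFn fun i => v i.succ))
        (fun y => iteratedFDerivWithin ℝ n f S y (fun i => Pi.single (v i.succ) (1 : ℝ))) S :=
      fun y hy => (ih _ hy).symm
    beta_reduce
    rw [fderivWithin_congr h1 (h1 hx)]
    have hd : DifferentiableWithinAt ℝ (iteratedFDerivWithin ℝ n f S) S x :=
      (hf.differentiableOn_iteratedFDerivWithin (m := n) (mod_cast ENat.natCast_lt_top n) hS) x hx
    have h2 := hd.hasFDerivWithinAt.continuousMultilinear_apply_const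
      (fun i => Pi.single (v i.succ) (1 : ℝ))
    rw [h2.fderivWithin (hS x hx)]
    rfl

/-- A permutation is generated by adjacent swaps, each being the symmetry of a second derivative. At
boundary points this symmetry comes from `hSi`. Reordering is needed because Faà di Bruno's formula
distributes the directions over blocks, while `mixedPartial` fixes one order. -/
lemma listPartial_perm (hS : UniqueDiffOn ℝ S) (hSi : S ⊆ closure (interior S))
    (hf : ContDiffOn ℝ ∞ f S) {l l' : List (Fin s)} (h : l.Perm l') :
    Set.EqOn (listPartial S f l) (listPartial S f l') S := by
  induction h with
  | nil => exact fun _ _ => rfl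
  | cons j _ ih =>
    intro x hx
    simp only [listPartial]
    rw [fderivWithin_congr ih (ih hx)]
  | swap i j l =>
    intro x hx
    have hl := contDiffOn_listPartial hS hf l
    have hd : DifferentiableWithinAt ℝ (fderivWithin ℝ (listPartial S f l) S) S x :=
      (hl.fderivWithin (m := ∞) hS (by simp)).differentiableOn (by simp) x hx
    have hap : ∀ k, fderivWithin ℝ (fun y => fderivWithin ℝ (listPartial S f l) S y
        (Pi.single k (1 : ℝ))) S x
        = (fderivWithin ℝ (fderivWithin ℝ (listPartial S f l) S) S x).flip (Pi.single k 1) := by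
      intro k
      have := hd.hasFDerivWithinAt.clm_apply (hasFDerivWithinAt_const (Pi.single k (1 : ℝ)) x S)
      rw [this.fderivWithin (hS x hx)]
      simp
    simp only [listPartial]
    rw [hap i, hap j]
    simp only [ContinuousLinearMap.flip_apply]
    exact (hl x hx).isSymmSndFDerivWithinAt (by simp; exact WithTop.coe_le_coe.2 (le_top : (2 : ℕ∞) ≤ ⊤)) hS (hSi hx) hx _ _
  | trans _ _ h1 h2 => exact h1.trans h2

/-- A list in which each index `j` occurs exactly `ν j` times, in increasing order. -/
def sortedList (ν : Fin s → ℕ) : List (Fin s) :=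
  List.ofFn (fun l => (finSigmaFinEquiv.symm l).1 : Fin (∑ j, ν j) → Fin s)

lemma count_sortedList (ν : Fin s → ℕ) (j : Fin s) : (sortedList ν).count j = ν j := by
  rw [sortedList, ← Multiset.coe_count, List.ofFn_eq_map, ← Multiset.map_coe]
  change Multiset.count j (Multiset.map _ (Finset.univ : Finset (Fin (∑ j, ν j))).val) = _
  rw [Multiset.count_map, ← Finset.filter_val, Finset.card_val]
  rw [← Fintype.card_subtype]
  rw [Fintype.card_congr ((finSigmaFinEquiv (n := ν)).symm.subtypeEquiv (p := fun l => j = _)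
    (q := fun a => j = a.1) (fun a => Iff.rfl))]
  rw [Fintype.card_congr ((Equiv.subtypeEquivRight fun a => eq_comm).trans
    (Equiv.sigmaSubtype j))]
  simp

lemma mixedPartial_eq_listPartial (hS : UniqueDiffOn ℝ S) (hSi : S ⊆ closure (interior S))
    (hf : ContDiffOn ℝ ∞ f S) (ν : Fin s → ℕ) (l : List (Fin s)) (hl : ∀ j, l.count j = ν j)
    {x : Fin s → ℝ} (hx : x ∈ S) :
    mixedPartial S f ν x = listPartial S f l x := by
  rw [mixedPartial, iteratedFDerivWithin_eq_listPartial hS hf _ hx]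
  refine listPartial_perm hS hSi hf (List.perm_iff_count.2 fun j => ?_) hx
  exact (count_sortedList ν j).trans (hl j).symm

lemma uniqueDiffOn_paramBox (s : ℕ) : UniqueDiffOn ℝ (paramBox s) := by
  rw [paramBox, ← Set.pi_univ_Icc]
  exact UniqueDiffOn.univ_pi fun _ => uniqueDiffOn_Icc (by norm_num)

lemma paramBox_subset_closure_interior (s : ℕ) :
    paramBox s ⊆ closure (interior (paramBox s)) := by
  rw [paramBox, ← Set.pi_univ_Icc, interior_pi_set Set.finite_univ, closure_pi_set]
  refine Set.pi_mono fun i _ => ?_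
  rw [interior_Icc, closure_Ioo (by norm_num)]

/-- A bound on the mixed partial derivatives bounds the derivatives in arbitrary coordinate
directions, taken in any order. -/
lemma norm_iteratedFDerivWithin_single_le (hS : UniqueDiffOn ℝ S) (hSi : S ⊆ closure (interior S))
    (hf : ContDiffOn ℝ ∞ f S) {C β : ℝ} {b : Fin s → ℝ} {x : Fin s → ℝ} (hx : x ∈ S)
    (hfb : ∀ ν : Fin s → ℕ, ‖mixedPartial S f ν x‖
      ≤ C * ((∑ j, ν j).factorial : ℝ) ^ β * ∏ j, b j ^ ν j) {n : ℕ} (v : Fin n → Fin s) :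
    ‖iteratedFDerivWithin ℝ n f S x (fun i => Pi.single (v i) (1 : ℝ))‖
      ≤ C * (n.factorial : ℝ) ^ β * ∏ i, b (v i) := by
  have h := hfb (fun j => (List.ofFn v).count j)
  rw [iteratedFDerivWithin_eq_listPartial hS hf v hx,
    ← mixedPartial_eq_listPartial hS hSi hf _ _ (fun j => rfl) hx]
  have h1 : ∑ j, (List.ofFn v).count j = n := by
    have := Multiset.sum_count_eq_card (s := (Finset.univ : Finset (Fin s))) (m := (List.ofFn v : Multiset (Fin s)))
      (by simp)
    simpa using this
  have h2 : ∏ j, b j ^ (List.ofFn v).count j = ∏ i, b (v i) := by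
    have := Finset.prod_multiset_map_count (List.ofFn v : Multiset (Fin s)) b
    rw [Multiset.map_coe, Multiset.prod_coe, List.map_ofFn, List.prod_ofFn] at this
    simp only [Function.comp_apply, Multiset.coe_count] at this
    rw [this]
    symm
    refine Finset.prod_subset (Finset.subset_univ _) fun j _ hj => ?_
    have : (List.ofFn v).count j = 0 := List.count_eq_zero.2 (by simpa using hj)
    simp [this]
  rwa [h1, h2] at h

end ListPartial

/-! ### Parametric regularity of the likelihood. -/

section InnerIntegrand

variable {s k : ℕ}

/-- The Gaussian likelihood `C_{k,Γ} exp(-‖y - g(x)‖²_{Γ⁻¹} / 2)` as a function of the model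
parameter, before periodization. -/
noncomputable def likelihood (Γ : Matrix (Fin k) (Fin k) ℝ)
    (g : (Fin s → ℝ) → EuclideanSpace ℝ (Fin k)) (y : EuclideanSpace ℝ (Fin k))
    (x : Fin s → ℝ) : ℝ :=
  gaussConst Γ * Real.exp (-(1 / 2) * precNorm Γ (y - g x) ^ 2)

lemma gaussConst_nonneg (Γ : Matrix (Fin k) (Fin k) ℝ) : 0 ≤ gaussConst Γ := by
  unfold gaussConst; positivity

/-- The data enter only as a translation of the outer Gaussian. Its derivative bounds hold at every
point, so the resulting estimates are uniform in y. -/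
lemma likelihood_eq_comp {Γ : Matrix (Fin k) (Fin k) ℝ}
    {B : EuclideanSpace ℝ (Fin k) →L[ℝ] EuclideanSpace ℝ (Fin k)}
    (hB : ∀ x, precNorm Γ x ^ 2 = ‖B x‖ ^ 2) (g : (Fin s → ℝ) → EuclideanSpace ℝ (Fin k))
    (y : EuclideanSpace ℝ (Fin k)) :
    likelihood Γ g y = (fun w => gaussConst Γ • stdGauss (w + B y)) ∘ ((-B) ∘ g) := by
  ext x
  simp only [likelihood, Function.comp_apply, stdGauss, hB, map_sub, smul_eq_mul, neg_apply]
  rw [neg_add_eq_sub]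

lemma contDiffOn_likelihood {Γ : Matrix (Fin k) (Fin k) ℝ} (hΓ : Γ.PosDef) {μ : ℝ} (hμ0 : 0 < μ)
    (hμ : ∀ i, μ ≤ hΓ.1.eigenvalues i) {g : (Fin s → ℝ) → EuclideanSpace ℝ (Fin k)}
    {S : Set (Fin s → ℝ)} (hg : ContDiffOn ℝ ∞ g S) (y : EuclideanSpace ℝ (Fin k)) :
    ContDiffOn ℝ ∞ (likelihood Γ g y) S := by
  obtain ⟨B, hB, -⟩ := exists_precNorm_eq_norm hΓ hμ0 hμ
  rw [likelihood_eq_comp hB]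
  have h : ContDiff ℝ ∞ (fun w => gaussConst Γ • stdGauss (w + B y)) :=
    ContDiff.const_smul _ (contDiff_stdGauss.comp (contDiff_id.add contDiff_const))
  exact h.comp_contDiffOn ((-B).contDiff.comp_contDiffOn hg)

/-- The parametric regularity of the likelihood, uniformly in the data `y`. -/
lemma norm_mixedPartial_likelihood_le {Γ : Matrix (Fin k) (Fin k) ℝ} (hΓ : Γ.PosDef) {μ : ℝ}
    (hμ0 : 0 < μ) (hμ1 : μ ≤ 1) (hμ : ∀ i, μ ≤ hΓ.1.eigenvalues i)
    {g : (Fin s → ℝ) → EuclideanSpace ℝ (Fin k)}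
    {S : Set (Fin s → ℝ)} (hS : UniqueDiffOn ℝ S) (hSi : S ⊆ closure (interior S))
    (hg : ContDiffOn ℝ ∞ g S) {C β : ℝ} (hC : 1 ≤ C) (hβ : 1 ≤ β) {b : Fin s → ℝ}
    (hb : ∀ j, 0 ≤ b j) {x : Fin s → ℝ} (hx : x ∈ S)
    (hfb : ∀ ν : Fin s → ℕ, ‖mixedPartial S g ν x‖
      ≤ C * ((∑ j, ν j).factorial : ℝ) ^ β * ∏ j, b j ^ ν j)
    (y : EuclideanSpace ℝ (Fin k)) (ν : Fin s → ℕ) :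
    |mixedPartial S (likelihood Γ g y) ν x| ≤ gaussConst Γ * Real.exp 7 * 2 ^ β
      * (C ^ (∑ j, ν j) * (2 : ℝ) ^ (β * (((∑ j, ν j : ℕ) : ℝ) - 1))
        * μ ^ (-(((∑ j, ν j : ℕ) : ℝ) / 2)) * ((∑ j, ν j).factorial : ℝ) ^ β
        * ∏ j, b j ^ ν j) := by
  have hc := gaussConst_nonneg Γ
  have hlik := contDiffOn_likelihood hΓ hμ0 hμ hg y
  obtain ⟨v, hv⟩ : ∃ v : Fin (∑ j, ν j) → Fin s, v = fun l => (finSigmaFinEquiv.symm l).1 :=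
    ⟨_, rfl⟩
  have hmp : mixedPartial S (likelihood Γ g y) ν x = iteratedFDerivWithin ℝ (∑ j, ν j)
      (likelihood Γ g y) S x (fun i => Pi.single (v i) (1 : ℝ)) := by rw [hv]; rfl
  have hprod : ∏ j, b j ^ ν j = ∏ i, b (v i) := by
    rw [hv, ← (finSigmaFinEquiv (n := ν)).prod_comp, Fintype.prod_sigma]
    simp
  rw [hmp, hprod]
  -- Only the list v of directions matters from here. Forgetting that it came from ν allows its
  -- length to be split into 0 and N + 1.
  clear hprod hmp hv
  generalize (∑ j, ν j) = n at v
  rcases n with _ | N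
  · have h1 : |likelihood Γ g y x| ≤ gaussConst Γ * 1 := by
      rw [likelihood, abs_mul, abs_of_nonneg hc, Real.abs_exp]
      gcongr
      rw [Real.exp_le_one_iff]
      nlinarith [sq_nonneg (precNorm Γ (y - g x))]
    -- At order zero the weight contains 2^{β(0-1)} = 2^{-β}; the factor 2^β in the constant is
    -- there to compensate it.
    have h2 : (2 : ℝ) ^ β * 2 ^ (-β) = 1 := by
      rw [← Real.rpow_add (by norm_num)]; simp
    simp
    calc |likelihood Γ g y x| ≤ gaussConst Γ * 1 := h1
      _ ≤ gaussConst Γ * Real.exp 7 := by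
        gcongr; exact Real.one_le_exp (by norm_num)
      _ = gaussConst Γ * Real.exp 7 * (2 ^ β * 2 ^ (-β)) := by rw [h2, mul_one]
      _ = _ := by ring
  · obtain ⟨B, hB, hBμ⟩ := exists_precNorm_eq_norm hΓ hμ0 hμ
    rw [likelihood_eq_comp hB, ← Real.norm_eq_abs]
    -- Each block of a partition contributes one factor Cμ^{-1/2}. Being at least 1, it can be
    -- raised from the number of blocks to the full order N + 1.
    have hD : 1 ≤ C * μ ^ (-(1 / 2) : ℝ) :=
      one_le_mul_of_one_le_of_one_le hC (Real.one_le_rpow_of_pos_of_le_one_of_nonpos hμ0 hμ1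
        (by norm_num))
    have hout : ContDiff ℝ ∞ (fun w => stdGauss (w + B y)) :=
      contDiff_stdGauss.comp (contDiff_id.add contDiff_const)
    have key := norm_iteratedFDerivWithin_comp_gevrey hS ((-B).contDiff.comp_contDiffOn hg)
      (g := fun w => gaussConst Γ • stdGauss (w + B y)) (hout.const_smul _)
      (A := gaussConst Γ * Real.exp 7) (by positivity) (fun l w => by
        have := iteratedFDeriv_const_smul_apply' (a := gaussConst Γ) (i := l) (x := w)
          (hout.contDiffAt.of_le (mod_cast le_top))
        rw [this, norm_smul, iteratedFDeriv_comp_add_right, Real.norm_of_nonneg hc, mul_assoc]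
        gcongr
        exact norm_iteratedFDeriv_stdGauss_le_factorial _ _)
      hD hβ hx N (fun i => Pi.single (v i) (1 : ℝ)) (fun i => b (v i)) (fun i => hb _)
      (fun m u hm => by
        rw [(-B).iteratedFDerivWithin_comp_left (hg x hx) hS hx (mod_cast le_top)]
        simp only [ContinuousLinearMap.compContinuousMultilinearMap_coe, Function.comp_apply,
          neg_apply, norm_neg]
        refine (hBμ _).trans ?_
        have := norm_iteratedFDerivWithin_single_le hS hSi hg hx hfb (fun i => v (u i))
        calc _ ≤ μ ^ (-(1 / 2) : ℝ) * (C * (m.factorial : ℝ) ^ β * ∏ i, b (v (u i))) := by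
              gcongr; exact this
          _ = _ := by ring)
    have hP : 0 ≤ ∏ i, b (v i) := Finset.prod_nonneg fun i _ => hb _
    have h2β : 1 ≤ (2 : ℝ) ^ β := Real.one_le_rpow (by norm_num) (by linarith)
    have e1 : -(1 / 2 : ℝ) * ((N + 1 : ℕ) : ℝ) = -(((N + 1 : ℕ) : ℝ) / 2) := by ring
    have e2 : (N : ℝ) * β = β * (((N + 1 : ℕ) : ℝ) - 1) := by push_cast; ring
    have h := key
    rw [Real.mul_rpow (by positivity) (by positivity), mul_pow, ← Real.rpow_natCast (2 : ℝ) N,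
      ← Real.rpow_mul (by norm_num), ← Real.rpow_natCast (μ ^ _), ← Real.rpow_mul hμ0.le,
      e1, e2] at h
    refine h.trans ?_
    calc _ = gaussConst Γ * Real.exp 7 * 1 * (C ^ (N + 1)
          * (2 : ℝ) ^ (β * (((N + 1 : ℕ) : ℝ) - 1)) * μ ^ (-(((N + 1 : ℕ) : ℝ) / 2))
          * ((N + 1).factorial : ℝ) ^ β * ∏ i, b (v i)) := by ring
      _ ≤ _ := by gcongr

end InnerIntegrand

/-! ### Chain rule coefficients for the substitution sin(2πt). -/

section TrigCoefficients

/-- The coefficients in `dⁿ/dtⁿ h(sin 2πt) = ∑_m trigCoeff n m t * h⁽ᵐ⁾(sin 2πt)`. -/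
noncomputable def trigCoeff : ℕ → ℕ → ℝ → ℝ
  | 0, 0 => fun _ => 1
  | 0, _ + 1 => fun _ => 0
  | n + 1, 0 => fun t => deriv (trigCoeff n 0) t
  | n + 1, m + 1 => fun t =>
      deriv (trigCoeff n (m + 1)) t + 2 * Real.pi * Real.cos (2 * Real.pi * t) * trigCoeff n m t

lemma contDiff_two_pi_cos :
    ContDiff ℝ ∞ (fun t : ℝ => 2 * Real.pi * Real.cos (2 * Real.pi * t)) :=
  contDiff_const.mul (Real.contDiff_cos.comp (contDiff_const.mul contDiff_id))

lemma contDiff_deriv_of_smooth {f : ℝ → ℝ} (hf : ContDiff ℝ ∞ f) : ContDiff ℝ ∞ (deriv f) :=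
  (contDiff_infty_iff_deriv.1 hf).2

lemma contDiff_trigCoeff (n m : ℕ) : ContDiff ℝ ∞ (trigCoeff n m) := by
  induction n generalizing m with
  | zero => rcases m with _ | m <;> exact contDiff_const
  | succ n ih =>
    rcases m with _ | m
    · exact contDiff_deriv_of_smooth (ih 0)
    · exact (contDiff_deriv_of_smooth (ih (m + 1))).add (contDiff_two_pi_cos.mul (ih m))

lemma trigCoeff_eq_zero_of_lt {n m : ℕ} (h : n < m) : trigCoeff n m = fun _ => 0 := by
  induction n generalizing m with
  | zero => rcases m with _ | m
            · omega
            · rfl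
  | succ n ih =>
    rcases m with _ | m
    · omega
    · ext t
      simp [trigCoeff, ih (show n < m + 1 by omega), ih (show n < m by omega)]

lemma abs_iteratedDeriv_two_pi_cos_le (i : ℕ) (t : ℝ) :
    |iteratedDeriv i (fun t : ℝ => 2 * Real.pi * Real.cos (2 * Real.pi * t)) t|
      ≤ (2 * Real.pi) ^ (i + 1) := by
  have hpi := Real.pi_pos
  rw [iteratedDeriv_const_mul_field, iteratedDeriv_comp_const_mul Real.contDiff_cos]
  beta_reduce
  rw [abs_mul, abs_mul _ (iteratedDeriv _ _ _), abs_pow,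
    abs_of_pos (by positivity : 0 < 2 * Real.pi), pow_succ, mul_comm (_ ^ i) (2 * Real.pi)]
  refine mul_le_mul_of_nonneg_left ?_ (by positivity)
  exact mul_le_of_le_one_right (by positivity) (Real.abs_iteratedDeriv_cos_le_one _ _)

/-- Each derivative costs at most 2πm, as for a trigonometric polynomial of degree m, so the
induction must carry all orders i. The derivative term supplies (m+1) S(n,m+1). In the cosine term,
Leibniz' rule sums binomially to (1+m)^i and supplies S(n,m). Together they form the Stirling
recurrence. For m = 0 the convention 0^0 = 1 is used. -/
lemma abs_iteratedDeriv_trigCoeff_le (n m i : ℕ) (t : ℝ) :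
    |iteratedDeriv i (trigCoeff n m) t|
      ≤ (2 * Real.pi) ^ (n + i) * (m : ℝ) ^ i * (n.stirlingSecond m : ℝ) := by
  have hpi := Real.pi_pos
  induction n generalizing m i t with
  | zero =>
    rcases m with _ | m
    · rcases i with _ | i
      · simp [trigCoeff]
      · have h : iteratedDeriv (i + 1) (trigCoeff 0 0) t = 0 := by
          rw [trigCoeff, iteratedDeriv_const]; simp
        rw [h, abs_zero]; positivity
    · have h : iteratedDeriv i (trigCoeff 0 (m + 1)) t = 0 := by
        rw [trigCoeff, iteratedDeriv_const]; simp
      rw [h, abs_zero]; positivity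
  | succ n ih =>
    rcases m with _ | m
    · have h := ih 0 (i + 1) t
      simp only [Nat.cast_zero, ne_eq, Nat.add_eq_zero_iff, one_ne_zero, and_false,
        not_false_eq_true, zero_pow, mul_zero, zero_mul] at h
      have h2 : iteratedDeriv i (trigCoeff (n + 1) 0) t = iteratedDeriv (i + 1) (trigCoeff n 0) t := by
        rw [iteratedDeriv_succ']; rfl
      rw [h2]
      exact h.trans (by positivity)
    · have hf : trigCoeff (n + 1) (m + 1) = deriv (trigCoeff n (m + 1)) +
          fun t => 2 * Real.pi * Real.cos (2 * Real.pi * t) * trigCoeff n m t := rfl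
      have hs1 := contDiff_deriv_of_smooth (contDiff_trigCoeff n (m + 1))
      have hs2 := contDiff_two_pi_cos.mul (contDiff_trigCoeff n m)
      rw [hf, iteratedDeriv_add (hs1.contDiffAt.of_le (mod_cast le_top))
        (hs2.contDiffAt.of_le (mod_cast le_top)), ← iteratedDeriv_succ']
      have h1 := ih (m + 1) (i + 1) t
      have h2 : |iteratedDeriv i (fun t => 2 * Real.pi * Real.cos (2 * Real.pi * t)
          * trigCoeff n m t) t| ≤ (2 * Real.pi) ^ (n + 1 + i) * ((m : ℝ) + 1) ^ i
            * (n.stirlingSecond m : ℝ) := by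
        have h3 := norm_iteratedFDeriv_mul_le contDiff_two_pi_cos (contDiff_trigCoeff n m) t
          (n := i) (mod_cast le_top)
        simp only [norm_iteratedFDeriv_eq_norm_iteratedDeriv, Real.norm_eq_abs] at h3
        refine h3.trans ?_
        rw [add_comm (m : ℝ) 1, add_pow, Finset.mul_sum, Finset.sum_mul]
        refine Finset.sum_le_sum fun j hj => ?_
        have hj' : j ≤ i := by simpa [Nat.lt_succ_iff] using hj
        calc (i.choose j : ℝ) * _ * _
            ≤ (i.choose j : ℝ) * (2 * Real.pi) ^ (j + 1)
              * ((2 * Real.pi) ^ (n + (i - j)) * (m : ℝ) ^ (i - j) * (n.stirlingSecond m : ℝ)) := by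
              gcongr
              · exact abs_iteratedDeriv_two_pi_cos_le _ _
              · exact ih _ _ _
          _ = _ := by
              have : n + 1 + i = (j + 1) + (n + (i - j)) := by omega
              rw [this, pow_add _ (j + 1)]
              simp only [one_pow]
              ring
      refine (abs_add_le _ _).trans ((add_le_add h1 h2).trans (le_of_eq ?_))
      rw [Nat.stirlingSecond_succ_succ]
      push_cast
      ring

lemma abs_trigCoeff_le (n m : ℕ) (t : ℝ) :
    |trigCoeff n m t| ≤ (2 * Real.pi) ^ n * (n.stirlingSecond m : ℝ) := by
  simpa using abs_iteratedDeriv_trigCoeff_le n m 0 t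

end TrigCoefficients

/-! ### Mixed derivatives of a function of sin(2πθ). -/

section PeriodizedDerivatives

variable {s : ℕ}

/-- The multi-indices componentwise at most `ν`. -/
def multiBox (ν : Fin s → ℕ) : Finset (Fin s → ℕ) :=
  Fintype.piFinset fun j => Finset.range (ν j + 1)

lemma mem_multiBox {ν m : Fin s → ℕ} : m ∈ multiBox ν ↔ ∀ j, m j ≤ ν j := by
  simp [multiBox]

/-- The mixed derivative of order `ν` of `θ ↦ h(sin 2πθ)`, where `ψ m θ` stands for
`(∂^m h)(sin 2πθ)`. -/
noncomputable def periodicDeriv (ψ : (Fin s → ℕ) → (Fin s → ℝ) → ℝ) (ν : Fin s → ℕ)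
    (θ : Fin s → ℝ) : ℝ :=
  ∑ m ∈ multiBox ν, (∏ j, trigCoeff (ν j) (m j) (θ j)) * ψ m θ

lemma periodicDeriv_zero (ψ : (Fin s → ℕ) → (Fin s → ℝ) → ℝ) : periodicDeriv ψ 0 = ψ 0 := by
  ext θ
  have h : multiBox (0 : Fin s → ℕ) = {0} := by
    ext m; simp [mem_multiBox, funext_iff]
  simp [periodicDeriv, h, trigCoeff]

/-- The product rule either differentiates the j-th coefficient or shifts m to m + e_j. Reindexing
the shifted terms reproduces the recursion that defines `trigCoeff`. -/
lemma hasLineDerivAt_periodicDeriv {ψ : (Fin s → ℕ) → (Fin s → ℝ) → ℝ}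
    (hψ : ∀ m j θ, HasLineDerivAt ℝ (ψ m)
      (2 * Real.pi * Real.cos (2 * Real.pi * θ j) * ψ (m + Pi.single j 1) θ) θ (Pi.single j 1))
    (ν : Fin s → ℕ) (j : Fin s) (θ : Fin s → ℝ) :
    HasLineDerivAt ℝ (periodicDeriv ψ ν) (periodicDeriv ψ (ν + Pi.single j 1) θ) θ
      (Pi.single j 1) := by
  set R : (Fin s → ℕ) → ℝ := fun m => ∏ i ∈ Finset.univ.erase j, trigCoeff (ν i) (m i) (θ i) with hR
  set c := 2 * Real.pi * Real.cos (2 * Real.pi * θ j) with hc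
  have hterm : ∀ m, HasDerivAt (fun t : ℝ => (∏ i, trigCoeff (ν i) (m i)
        ((θ + t • (Pi.single j 1 : Fin s → ℝ)) i)) * ψ m (θ + t • (Pi.single j 1 : Fin s → ℝ)))
      (deriv (trigCoeff (ν j) (m j)) (θ j) * R m * ψ m θ
        + trigCoeff (ν j) (m j) (θ j) * R m * (c * ψ (m + Pi.single j 1) θ)) 0 := by
    intro m
    have h1 : (fun t : ℝ => ∏ i, trigCoeff (ν i) (m i) ((θ + t • (Pi.single j 1 : Fin s → ℝ)) i))
        = fun t => trigCoeff (ν j) (m j) (θ j + t) * R m := by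
      ext t
      rw [← Finset.mul_prod_erase _ _ (Finset.mem_univ j)]
      congr 1
      · simp
      · refine Finset.prod_congr rfl fun i hi => ?_
        simp [Pi.single_eq_of_ne (Finset.ne_of_mem_erase hi)]
    have h2 : HasDerivAt (fun t : ℝ => trigCoeff (ν j) (m j) (θ j + t) * R m)
        (deriv (trigCoeff (ν j) (m j)) (θ j) * R m) 0 := by
      have h3 : HasDerivAt (trigCoeff (ν j) (m j)) (deriv (trigCoeff (ν j) (m j)) (θ j)) (θ j + 0) := by
        rw [add_zero]
        exact ((contDiff_trigCoeff _ _).differentiable (by simp) _).hasDerivAt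
      exact (h3.comp_const_add (θ j) 0).mul_const _
    have h4 := (h1 ▸ h2 : HasDerivAt (fun t : ℝ => ∏ i, trigCoeff (ν i) (m i)
        ((θ + t • (Pi.single j 1 : Fin s → ℝ)) i)) _ 0).mul (hψ m j θ)
    refine h4.congr_deriv ?_
    have h5 := congrFun h1 0
    simp only [zero_smul, add_zero] at h5 ⊢
    rw [h5]
  have hsum := HasDerivAt.fun_sum fun m (_ : m ∈ multiBox ν) => hterm m
  refine HasDerivAt.congr_deriv hsum ?_
  rw [Finset.sum_add_distrib]
  have hprod : ∀ m, (∏ i, trigCoeff ((ν + Pi.single j 1 : Fin s → ℕ) i) (m i) (θ i))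
      = trigCoeff (ν j + 1) (m j) (θ j) * R m := by
    intro m
    rw [← Finset.mul_prod_erase _ _ (Finset.mem_univ j)]
    congr 1
    · simp
    · refine Finset.prod_congr rfl fun i hi => ?_
      simp [Pi.single_eq_of_ne (Finset.ne_of_mem_erase hi)]
  have hRadd : ∀ m, R (m + Pi.single j 1) = R m := by
    intro m
    simp only [hR]
    refine Finset.prod_congr rfl fun i hi => ?_
    simp [Pi.single_eq_of_ne (Finset.ne_of_mem_erase hi)]
  set A : (Fin s → ℕ) → ℝ := fun m => if m j = 0 then 0 else
    c * trigCoeff (ν j) (m j - 1) (θ j) * R m * ψ m θ with hA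
  have hrec : ∀ m, (trigCoeff (ν j + 1) (m j) (θ j) * R m) * ψ m θ
      = deriv (trigCoeff (ν j) (m j)) (θ j) * R m * ψ m θ + A m := by
    intro m
    simp only [hA]
    rcases hm : m j with _ | q
    · simp [trigCoeff]
    · simp only [trigCoeff, Nat.add_eq_zero_iff, one_ne_zero, and_false, if_false,
        Nat.add_sub_cancel]
      ring
  rw [periodicDeriv]
  simp_rw [hprod, hrec]
  rw [Finset.sum_add_distrib]
  -- The two halves are compared separately. Enlarging the box in direction j adds only terms with
  -- m_j > ν_j, whose coefficients vanish. The shift m ↦ m + e_j misses only m_j = 0, where A was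
  -- set to zero.
  congr 1
  · refine Finset.sum_subset (fun m hm => ?_) fun m hm hm' => ?_
    · rw [mem_multiBox] at hm ⊢
      intro i
      exact (hm i).trans (by simp)
    · have : ν j < m j := by
        rw [mem_multiBox] at hm hm'
        push Not at hm'
        obtain ⟨i, hi⟩ := hm'
        rcases eq_or_ne i j with rfl | hij
        · exact hi
        · have := hm i
          simp [hij] at this
          omega
      rw [trigCoeff_eq_zero_of_lt this]; simp
  · refine Finset.sum_of_injOn (fun m => m + Pi.single j 1) (add_left_injective _).injOn ?_ ?_ ?_
    · intro m hm
      simp only [Finset.mem_coe, mem_multiBox] at hm ⊢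
      intro i
      exact Nat.add_le_add_right (hm i) _
    · intro m hm hm'
      by_cases h0 : m j = 0
      · simp [hA, h0]
      · exfalso
        apply hm'
        refine ⟨fun i => m i - (Pi.single j 1 : Fin s → ℕ) i, ?_, ?_⟩
        · simp only [Finset.mem_coe, mem_multiBox] at hm ⊢
          intro i
          have := hm i
          simp only [Pi.add_apply] at this
          omega
        · ext i
          rcases eq_or_ne i j with rfl | hij
          · simp; omega
          · simp [hij]
    · intro m _
      simp only [hA, hRadd]
      simp
      ring

lemma abs_periodicDeriv_le {ψ : (Fin s → ℕ) → (Fin s → ℝ) → ℝ} {M : (Fin s → ℕ) → ℝ}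
    (hM : ∀ m θ, |ψ m θ| ≤ M m) (ν : Fin s → ℕ) (θ : Fin s → ℝ) :
    |periodicDeriv ψ ν θ| ≤ (2 * Real.pi) ^ (∑ j, ν j)
      * ∑ m ∈ multiBox ν, (∏ j, ((ν j).stirlingSecond (m j) : ℝ)) * M m := by
  rw [periodicDeriv, Finset.mul_sum]
  refine (Finset.abs_sum_le_sum_abs _ _).trans (Finset.sum_le_sum fun m _ => ?_)
  rw [abs_mul, Finset.abs_prod, ← mul_assoc]
  refine mul_le_mul ?_ (hM m θ) (abs_nonneg _) (by positivity)
  refine (Finset.prod_le_prod (fun _ _ => abs_nonneg _)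
    fun j _ => abs_trigCoeff_le (ν j) (m j) (θ j)).trans (le_of_eq ?_)
  rw [Finset.prod_mul_distrib, Finset.prod_pow_eq_pow_sum]

lemma continuous_periodicDeriv {ψ : (Fin s → ℕ) → (Fin s → ℝ) → ℝ}
    (hψ : ∀ m, Continuous (ψ m)) (ν : Fin s → ℕ) : Continuous (periodicDeriv ψ ν) := by
  unfold periodicDeriv
  refine continuous_finsetSum _ fun m _ => Continuous.mul ?_ (hψ m)
  exact continuous_finsetProd _ fun j _ =>
    (contDiff_trigCoeff _ _).continuous.comp (continuous_apply j)

end PeriodizedDerivatives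

/-! ### Periodicity and weighted bounds for the periodized likelihood. -/

section PeriodizedLikelihood

variable {s : ℕ}

lemma periodic_trigCoeff (n m : ℕ) : Function.Periodic (trigCoeff n m) 1 := by
  have hd : ∀ f : ℝ → ℝ, Function.Periodic f 1 → Function.Periodic (deriv f) 1 := by
    intro f hf t
    rw [← deriv_comp_add_const, show (fun x => f (x + 1)) = f from funext hf]
  induction n generalizing m with
  | zero => rcases m with _ | m <;> exact fun _ => rfl
  | succ n ih =>
    rcases m with _ | m
    · exact hd _ (ih 0)
    · intro t
      simp only [trigCoeff]
      rw [hd _ (ih (m + 1)) t, ih m t, mul_add, mul_one, Real.cos_add_two_pi]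

/-- The componentwise map `θ ↦ sin (2πθ)`. -/
noncomputable def sinMap (θ : Fin s → ℝ) : Fin s → ℝ := fun j => Real.sin (2 * Real.pi * θ j)

lemma sinMap_mem_paramBox (θ : Fin s → ℝ) : sinMap θ ∈ paramBox s :=
  ⟨fun _ => Real.neg_one_le_sin _, fun _ => Real.sin_le_one _⟩

lemma continuous_sinMap : Continuous (sinMap : (Fin s → ℝ) → _) := by
  unfold sinMap; fun_prop

lemma sinMap_add_single (θ : Fin s → ℝ) (j : Fin s) : sinMap (θ + Pi.single j 1) = sinMap θ := by
  ext i
  rcases eq_or_ne i j with rfl | h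
  · simp [sinMap, mul_add, Real.sin_add_two_pi]
  · simp [sinMap, h]

lemma hasLineDerivAt_mixedPartial_sinMap {g : (Fin s → ℝ) → ℝ}
    (hg : ContDiffOn ℝ ∞ g (paramBox s)) (m : Fin s → ℕ) (j : Fin s) (θ : Fin s → ℝ) :
    HasLineDerivAt ℝ (fun θ => mixedPartial (paramBox s) g m (sinMap θ))
      (2 * Real.pi * Real.cos (2 * Real.pi * θ j)
        * mixedPartial (paramBox s) g (m + Pi.single j 1) (sinMap θ)) θ (Pi.single j 1) := by
  have hS := uniqueDiffOn_paramBox s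
  have hSi := paramBox_subset_closure_interior s
  have h1 : (fun θ : Fin s → ℝ => mixedPartial (paramBox s) g m (sinMap θ))
      = fun θ => listPartial (paramBox s) g (sortedList m) (sinMap θ) := by
    ext θ
    exact mixedPartial_eq_listPartial hS hSi hg m _ (count_sortedList m) (sinMap_mem_paramBox θ)
  have h2 : mixedPartial (paramBox s) g (m + Pi.single j 1) (sinMap θ)
      = listPartial (paramBox s) g (j :: sortedList m) (sinMap θ) := by
    refine mixedPartial_eq_listPartial hS hSi hg _ _ (fun i => ?_) (sinMap_mem_paramBox θ)
    rw [List.count_cons, count_sortedList, Pi.add_apply]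
    rcases eq_or_ne j i with rfl | h
    · simp
    · simp [h, h.symm]
  rw [h1, h2]
  have hd := ((contDiffOn_listPartial hS hg (sortedList m)).differentiableOn (by simp)
    (sinMap θ) (sinMap_mem_paramBox θ)).hasFDerivWithinAt
  have hc : HasDerivAt (fun t : ℝ => sinMap (θ + t • (Pi.single j 1 : Fin s → ℝ)))
      (Pi.single j (2 * Real.pi * Real.cos (2 * Real.pi * θ j))) 0 := by
    rw [hasDerivAt_pi]
    intro i
    rcases eq_or_ne i j with rfl | hij
    · simp only [sinMap, Pi.add_apply, Pi.smul_apply, Pi.single_eq_same, smul_eq_mul, mul_one]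
      have h3 : HasDerivAt (fun t : ℝ => 2 * Real.pi * (θ i + t)) (2 * Real.pi) 0 := by
        simpa using ((hasDerivAt_id (0 : ℝ)).const_add (θ i)).const_mul (2 * Real.pi)
      have h4 := h3.sin
      rw [add_zero] at h4
      rwa [mul_comm (2 * Real.pi) (Real.cos _)]
    · simp only [sinMap, Pi.add_apply, Pi.smul_apply, Pi.single_eq_of_ne hij, smul_eq_mul,
        mul_zero, add_zero]
      exact hasDerivAt_const _ _
  have hd' : HasFDerivWithinAt (listPartial (paramBox s) g (sortedList m))
      (fderivWithin ℝ (listPartial (paramBox s) g (sortedList m)) (paramBox s) (sinMap θ))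
      (paramBox s) (sinMap (θ + (0 : ℝ) • (Pi.single j 1 : Fin s → ℝ))) := by
    simpa using hd
  -- The sine map reaches the faces of the box, where g has only derivatives within the box. These
  -- suffice because the curve never leaves the box.
  have h5 := hd'.comp_hasDerivAt (0 : ℝ) hc (Filter.Eventually.of_forall
    fun t => sinMap_mem_paramBox _)
  refine HasDerivAt.congr_deriv h5 ?_
  rw [← mul_one (2 * Real.pi * Real.cos (2 * Real.pi * θ j)), ← smul_eq_mul _ (1 : ℝ),
    Pi.single_smul', map_smul]
  simp [listPartial]

lemma continuous_mixedPartial_sinMap {g : (Fin s → ℝ) → ℝ}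
    (hg : ContDiffOn ℝ ∞ g (paramBox s)) (m : Fin s → ℕ) :
    Continuous (fun θ => mixedPartial (paramBox s) g m (sinMap θ)) := by
  have hS := uniqueDiffOn_paramBox s
  have hSi := paramBox_subset_closure_interior s
  have h1 : (fun θ : Fin s → ℝ => mixedPartial (paramBox s) g m (sinMap θ))
      = fun θ => listPartial (paramBox s) g (sortedList m) (sinMap θ) := by
    ext θ
    exact mixedPartial_eq_listPartial hS hSi hg m _ (count_sortedList m) (sinMap_mem_paramBox θ)
  rw [h1]
  exact (contDiffOn_listPartial hS hg (sortedList m)).continuousOn.comp_continuous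
    continuous_sinMap sinMap_mem_paramBox

lemma prod_extend_zero {M : Type*} [CommMonoid M] (u : Finset (Fin s)) (m : u → ℕ)
    (F : Fin s → ℕ → M) (hF : ∀ j ∉ u, F j 0 = 1) :
    ∏ j, F j (if h : j ∈ u then m ⟨j, h⟩ else 0) = ∏ j : u, F j (m j) := by
  rw [← Finset.prod_subset (Finset.subset_univ u) (fun j _ hj => by rw [dif_neg hj, hF j hj]),
    ← Finset.prod_coe_sort u]
  exact Finset.prod_congr rfl fun j _ => by rw [dif_pos j.2]

/-- Since S(α,0) = 0 for α ≥ 1, a multi-index vanishing somewhere on u contributes nothing. Outside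
u the order is 0 and S(0,0) = 1, so only {1,…,α}^u remains. -/
lemma sum_multiBox_eq_spodWeight (C β μ : ℝ) (b : ℕ → ℝ) {α : ℕ} (hα : 1 ≤ α)
    (u : Finset (Fin s)) :
    ∑ m ∈ multiBox (fun j => if j ∈ u then α else 0),
      (∏ j, (((if j ∈ u then α else 0 : ℕ).stirlingSecond (m j) : ℕ) : ℝ))
        * (C ^ (∑ j, m j) * (2 : ℝ) ^ (β * (((∑ j, m j : ℕ) : ℝ) - 1))
          * μ ^ (-(((∑ j, m j : ℕ) : ℝ) / 2)) * ((∑ j, m j).factorial : ℝ) ^ β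
          * ∏ j : Fin s, b (j : ℕ) ^ m j)
      = spodWeight C β μ b α u := by
  rw [spodWeight]
  symm
  refine Finset.sum_of_injOn (fun m j => if h : j ∈ u then m ⟨j, h⟩ else 0) ?_ ?_ ?_ ?_
  · intro m _ m' _ h
    ext j
    have := congrFun h j
    simpa using this
  · intro m hm
    simp only [Finset.mem_coe, Fintype.mem_piFinset, Finset.mem_Icc, mem_multiBox] at hm ⊢
    intro j
    split_ifs with h
    · exact (hm ⟨j, h⟩).2
    · exact le_rfl
  · intro m hm hm'
    obtain ⟨j, hj, hmj⟩ : ∃ j ∈ u, m j = 0 := by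
      by_contra hcon
      push Not at hcon
      rw [mem_multiBox] at hm
      refine hm' ⟨fun j => m j, ?_, ?_⟩
      · simp only [Finset.mem_coe, Fintype.mem_piFinset, Finset.mem_Icc]
        intro j
        have := hm j
        rw [if_pos j.2] at this
        exact ⟨Nat.one_le_iff_ne_zero.2 (hcon j j.2), this⟩
      · ext j
        have := hm j
        by_cases h : j ∈ u
        · simp [h]
        · simp [h] at this
          simp [h, this]
    rw [Finset.prod_eq_zero (Finset.mem_univ j), zero_mul]
    rw [if_pos hj, hmj]
    obtain ⟨a, rfl⟩ : ∃ a, α = a + 1 := ⟨α - 1, by omega⟩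
    simp
  · intro m _
    have h1 : ∑ j : Fin s, (if h : j ∈ u then m ⟨j, h⟩ else 0) = ∑ j : u, m j := by
      have := prod_extend_zero u m (fun _ n => Multiplicative.ofAdd n) (fun j _ => rfl)
      exact this
    have h2 := prod_extend_zero u m (fun j n => b (j : ℕ) ^ n) (fun j _ => pow_zero _)
    have h3 := prod_extend_zero u m
      (fun j n => (((if j ∈ u then α else 0 : ℕ).stirlingSecond n : ℕ) : ℝ))
      (fun j hj => by simp [hj])
    simp only [h1, h2, h3]
    rw [Finset.prod_mul_distrib]
    have h4 : ∏ j : u, (((if (j : Fin s) ∈ u then α else 0 : ℕ).stirlingSecond (m j) : ℕ) : ℝ)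
        = ∏ j : u, ((α.stirlingSecond (m j) : ℕ) : ℝ) :=
      Finset.prod_congr rfl fun j _ => by rw [if_pos j.2]
    rw [h4]
    ring

/-- The mixed derivatives of the periodized likelihood: continuous, periodic functions that are
successive partial derivatives of one another, with those of order `α` in the variables of `u`
bounded by a multiple of the weight `γ_u`. -/
lemma exists_periodic_derivatives {k : ℕ} {Γ : Matrix (Fin k) (Fin k) ℝ} (hΓ : Γ.PosDef) {μ : ℝ}
    (hμ0 : 0 < μ) (hμ1 : μ ≤ 1) (hμ : ∀ i, μ ≤ hΓ.1.eigenvalues i) {C β : ℝ} (hC : 1 ≤ C)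
    (hβ : 1 ≤ β) {b : ℕ → ℝ} (hb : ∀ j, 0 ≤ b j) {g : (Fin s → ℝ) → EuclideanSpace ℝ (Fin k)}
    (hg : ContDiffOn ℝ ∞ g (paramBox s))
    (hgb : ∀ θ ∈ paramBox s, ∀ ν : Fin s → ℕ, ‖mixedPartial (paramBox s) g ν θ‖
        ≤ C * ((∑ j, ν j).factorial : ℝ) ^ β * ∏ j : Fin s, b (j : ℕ) ^ ν j)
    (y : EuclideanSpace ℝ (Fin k)) {α : ℕ} (hα : 1 ≤ α) :
    ∃ D : (Fin s → ℕ) → (Fin s → ℝ) → ℝ, D 0 = fPer Γ g y ∧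
      (∀ ν j θ, HasLineDerivAt ℝ (D ν) (D (ν + Pi.single j 1) θ) θ (Pi.single j 1)) ∧
      (∀ ν, Continuous (D ν)) ∧ (∀ ν j θ, D ν (θ + Pi.single j 1) = D ν θ) ∧
      ∀ (u : Finset (Fin s)) θ, |D (fun j => if j ∈ u then α else 0) θ|
        ≤ (2 * Real.pi) ^ (∑ j : Fin s, if j ∈ u then α else 0)
          * (gaussConst Γ * Real.exp 7 * 2 ^ β * spodWeight C β μ b α u) := by
  have hL := contDiffOn_likelihood hΓ hμ0 hμ hg y
  refine ⟨periodicDeriv fun m θ => mixedPartial (paramBox s) (likelihood Γ g y) m (sinMap θ),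
    ?_, ?_, ?_, ?_, ?_⟩
  · rw [periodicDeriv_zero]
    ext θ
    exact mixedPartial_eq_listPartial (uniqueDiffOn_paramBox s)
      (paramBox_subset_closure_interior s) hL 0 [] (fun _ => rfl) (sinMap_mem_paramBox θ)
  · exact hasLineDerivAt_periodicDeriv fun m j θ => hasLineDerivAt_mixedPartial_sinMap hL m j θ
  · exact continuous_periodicDeriv (continuous_mixedPartial_sinMap hL)
  · intro ν j θ
    simp only [periodicDeriv, sinMap_add_single]
    refine Finset.sum_congr rfl fun m _ => ?_
    congr 1
    refine Finset.prod_congr rfl fun i _ => ?_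
    rcases eq_or_ne i j with rfl | h
    · rw [Pi.add_apply, Pi.single_eq_same, periodic_trigCoeff]
    · simp [h]
  · intro u θ
    refine (abs_periodicDeriv_le (fun m θ => norm_mixedPartial_likelihood_le hΓ hμ0 hμ1 hμ
      (uniqueDiffOn_paramBox s) (paramBox_subset_closure_interior s) hg hC hβ
      (b := fun j => b j) (fun j => hb _) (sinMap_mem_paramBox θ)
      (hgb _ (sinMap_mem_paramBox θ)) y m) _ θ).trans (le_of_eq ?_)
    congr 1
    rw [← sum_multiBox_eq_spodWeight C β μ b hα u, Finset.mul_sum]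
    exact Finset.sum_congr rfl fun m _ => by ring

end PeriodizedLikelihood

/-! ### Fourier coefficients of periodic functions and of their derivatives. -/

section FourierAnalysis

open MeasureTheory Set UnitAddTorus

variable {s : ℕ}

/-- The quotient map from `ℝ^s` to the torus. -/
def toTorus (θ : Fin s → ℝ) : UnitAddTorus (Fin s) := fun j => (θ j : UnitAddCircle)

lemma isOpenQuotientMap_toTorus : IsOpenQuotientMap (toTorus : (Fin s → ℝ) → _) :=
  IsOpenQuotientMap.piMap fun _ => QuotientAddGroup.isOpenQuotientMap_mk

lemma periodic_int_vector {f : (Fin s → ℝ) → ℝ} (hf : ∀ j θ, f (θ + Pi.single j 1) = f θ)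
    {θ θ' : Fin s → ℝ} (h : toTorus θ = toTorus θ') : f θ = f θ' := by
  have h1 : ∀ j, ∃ z : ℤ, θ j = θ' j + z := by
    intro j
    have := congrFun h j
    simp only [toTorus] at this
    rw [QuotientAddGroup.eq] at this
    obtain ⟨z, hz⟩ := AddSubgroup.mem_zmultiples_iff.1 this
    refine ⟨-z, ?_⟩
    simp at hz ⊢
    linarith
  choose z hz using h1
  have hper : Function.Periodic f (∑ j, z j • (Pi.single j 1 : Fin s → ℝ)) := by
    refine Finset.sum_induction _ (Function.Periodic f) (fun a b ha hb => ha.add_period hb)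
      (fun x => by simp) fun j _ => ?_
    exact Function.Periodic.zsmul (hf j) (z j)
  have h2 : θ = θ' + ∑ j, z j • (Pi.single j 1 : Fin s → ℝ) := by
    ext i
    simp [hz i, Finset.sum_apply, Pi.single_apply]
  rw [h2, hper]

/-- A continuous function on the torus from a continuous periodic function. -/
noncomputable def torusLift (f : (Fin s → ℝ) → ℝ) (hc : Continuous f)
    (hf : ∀ j θ, f (θ + Pi.single j 1) = f θ) : C(UnitAddTorus (Fin s), ℂ) where
  toFun x := f (Function.surjInv isOpenQuotientMap_toTorus.surjective x)
  continuous_toFun := by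
    rw [isOpenQuotientMap_toTorus.isQuotientMap.continuous_iff]
    have : (fun x => (f (Function.surjInv isOpenQuotientMap_toTorus.surjective x) : ℂ)) ∘ toTorus
        = fun θ : Fin s → ℝ => (f θ : ℂ) := by
      ext θ
      simp only [Function.comp_apply]
      rw [periodic_int_vector hf (Function.surjInv_eq isOpenQuotientMap_toTorus.surjective _)]
    rw [this]
    fun_prop

variable {f : (Fin s → ℝ) → ℝ} (hc : Continuous f) (hf : ∀ j θ, f (θ + Pi.single j 1) = f θ)

lemma torusLift_toTorus (θ : Fin s → ℝ) : torusLift f hc hf (toTorus θ) = f θ := by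
  change ((f (Function.surjInv isOpenQuotientMap_toTorus.surjective (toTorus θ)) : ℝ) : ℂ) = _
  rw [periodic_int_vector hf (Function.surjInv_eq isOpenQuotientMap_toTorus.surjective _)]

/-- The half-open unit cube with lower corner `a`. -/
def unitCube (a : Fin s → ℝ) : Set (Fin s → ℝ) := {x | ∀ i, x i ∈ Ioc (a i) (a i + 1)}

lemma unitCube_eq_pi (a : Fin s → ℝ) :
    unitCube a = Set.pi Set.univ fun i => Ioc (a i) (a i + 1) := by
  ext x; simp [unitCube]

lemma measurableSet_unitCube (a : Fin s → ℝ) : MeasurableSet (unitCube a) := by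
  rw [unitCube_eq_pi]
  exact MeasurableSet.univ_pi fun i => measurableSet_Ioc

lemma volume_unitCube (a : Fin s → ℝ) : volume (unitCube a) = 1 := by
  rw [unitCube_eq_pi, Real.volume_pi_Ioc]
  simp

lemma torusCoeff_eq_integral (h : Fin s → ℤ) (a : Fin s → ℝ) :
    mFourierCoeff (torusLift f hc hf) h
      = ∫ θ in unitCube a, mFourier (-h) (toTorus θ) * (f θ : ℂ) := by
  rw [mFourierCoeff_eq_integral _ _ a]
  refine setIntegral_congr_fun (measurableSet_unitCube a) fun θ _ => ?_
  change mFourier (-h) (toTorus θ) • torusLift f hc hf (toTorus θ) = _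
  rw [torusLift_toTorus, smul_eq_mul]

lemma mFourier_toTorus (h : Fin s → ℤ) (θ : Fin s → ℝ) :
    mFourier h (toTorus θ) = Complex.exp (2 * Real.pi * Complex.I * ∑ j, (h j : ℂ) * (θ j : ℂ)) := by
  change ∏ j, fourier (h j) (θ j : UnitAddCircle) = _
  simp_rw [fourier_coe_apply]
  rw [← Complex.exp_sum, Finset.mul_sum]
  congr 1
  refine Finset.sum_congr rfl fun j _ => ?_
  simp
  ring

lemma mFourier_toTorus_add (h : Fin s → ℤ) (θ : Fin s → ℝ) (j : Fin s) (t : ℝ) :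
    mFourier (-h) (toTorus (θ + t • (Pi.single j 1 : Fin s → ℝ)))
      = Complex.exp (-(2 * Real.pi * Complex.I * h j) * t) * mFourier (-h) (toTorus θ) := by
  rw [mFourier_toTorus, mFourier_toTorus, ← Complex.exp_add]
  congr 1
  simp only [Pi.neg_apply, Int.cast_neg, Pi.add_apply, Pi.smul_apply, smul_eq_mul,
    Complex.ofReal_add, Complex.ofReal_mul, mul_add, Finset.sum_add_distrib]
  rw [add_comm]
  congr 1
  rw [Finset.sum_eq_single j]
  · simp; ring
  · intro i _ hij
    simp [hij]
  · simp

lemma continuous_mFourier_toTorus (h : Fin s → ℤ) :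
    Continuous fun θ : Fin s → ℝ => mFourier h (toTorus θ) :=
  (mFourier h).continuous.comp isOpenQuotientMap_toTorus.continuous

lemma norm_mFourier_toTorus (h : Fin s → ℤ) (θ : Fin s → ℝ) : ‖mFourier h (toTorus θ)‖ = 1 := by
  change ‖∏ j, fourier (h j) (θ j : UnitAddCircle)‖ = 1
  rw [norm_prod]
  exact Finset.prod_eq_one fun j _ => by rw [fourier_apply, Circle.norm_coe]

lemma norm_torusCoeff_le {M : ℝ} (hM : ∀ θ, |f θ| ≤ M) (h : Fin s → ℤ) :
    ‖mFourierCoeff (torusLift f hc hf) h‖ ≤ M := by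
  rw [torusCoeff_eq_integral hc hf h 0]
  have := norm_setIntegral_le_of_norm_le_const (μ := volume) (s := unitCube (0 : Fin s → ℝ))
    (f := fun θ => mFourier (-h) (toTorus θ) * (f θ : ℂ)) (C := M)
    (by rw [volume_unitCube]; exact ENNReal.one_lt_top) (fun θ _ => by
      rw [norm_mul, norm_mFourier_toTorus, one_mul, Complex.norm_real]; exact hM θ)
  simpa [Measure.real, volume_unitCube] using this

lemma exists_bound_of_periodic {f : (Fin s → ℝ) → ℝ} (hc : Continuous f)
    (hf : ∀ j θ, f (θ + Pi.single j 1) = f θ) : ∃ M, ∀ θ, |f θ| ≤ M := by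
  refine ⟨‖torusLift f hc hf‖, fun θ => ?_⟩
  have := (torusLift f hc hf).norm_coe_le_norm (toTorus θ)
  rwa [torusLift_toTorus, Complex.norm_real] at this

/-- Differentiation in a coordinate direction multiplies the Fourier coefficients. -/
lemma torusCoeff_lineDeriv {f' : (Fin s → ℝ) → ℝ} (hc' : Continuous f')
    (hf' : ∀ j θ, f' (θ + Pi.single j 1) = f' θ) (j : Fin s)
    (hd : ∀ θ, HasLineDerivAt ℝ f (f' θ) θ (Pi.single j 1)) (h : Fin s → ℤ) :
    mFourierCoeff (torusLift f' hc' hf') h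
      = 2 * Real.pi * Complex.I * h j * mFourierCoeff (torusLift f hc hf) h := by
  set w : Fin s → ℝ := Pi.single j 1 with hw
  set c := mFourierCoeff (torusLift f hc hf) h with hcdef
  set κ : ℂ := 2 * Real.pi * Complex.I * h j with hκ
  obtain ⟨M, hM⟩ := exists_bound_of_periodic hc' hf'
  have hline : Continuous fun p : (Fin s → ℝ) × ℝ => p.1 + p.2 • w := by fun_prop
  -- Translation replaces integration by parts: shifting f by t e_j multiplies its coefficient by
  -- exp(κt). Differentiating this identity at t = 0, on one side under the integral sign, gives the
  -- claim.
  have hI : ∀ t : ℝ, ∫ θ in unitCube 0, mFourier (-h) (toTorus θ) * (f (θ + t • w) : ℂ)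
      = Complex.exp (κ * t) * c := by
    intro t
    have h1 : ∀ θ, mFourier (-h) (toTorus θ) * (f (θ + t • w) : ℂ) = Complex.exp (κ * t)
        * (mFourier (-h) (toTorus (θ + t • w)) * (f (θ + t • w) : ℂ)) := by
      intro θ
      rw [hw, mFourier_toTorus_add, ← mul_assoc, ← mul_assoc, ← Complex.exp_add, ← hκ, neg_mul,
        add_neg_cancel, Complex.exp_zero, one_mul]
    simp_rw [h1]
    rw [integral_const_mul]
    congr 1
    rw [hcdef, torusCoeff_eq_integral hc hf h (t • w)]
    have h2 := (measurePreserving_add_right (volume : Measure (Fin s → ℝ)) (t • w)).setIntegral_preimage_emb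
      (measurableEmbedding_addRight _) (fun θ => mFourier (-h) (toTorus θ) * (f θ : ℂ))
      (unitCube (t • w))
    rw [← h2]
    congr 2
    ext θ
    simp only [unitCube, mem_ofPred_eq, mem_preimage, Pi.zero_apply, Pi.add_apply, mem_Ioc]
    refine forall_congr' fun i => ?_
    constructor <;> rintro ⟨h3, h4⟩ <;> constructor <;> linarith
  have hfin : IsFiniteMeasure ((volume : Measure (Fin s → ℝ)).restrict (unitCube 0)) :=
    ⟨by rw [Measure.restrict_apply_univ, volume_unitCube]; exact ENNReal.one_lt_top⟩
  have hcont : ∀ {F : (Fin s → ℝ) → ℝ}, Continuous F → ∀ t : ℝ, Continuous fun θ : Fin s → ℝ =>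
      mFourier (-h) (toTorus θ) * (F (θ + t • w) : ℂ) := by
    intro F hF t
    have := hF.comp (by fun_prop : Continuous fun θ : Fin s → ℝ => θ + t • w)
    exact (continuous_mFourier_toTorus _).mul (Complex.continuous_ofReal.comp this)
  obtain ⟨M0, hM0⟩ := exists_bound_of_periodic hc hf
  have key := hasDerivAt_integral_of_dominated_loc_of_deriv_le
    (μ := (volume : Measure (Fin s → ℝ)).restrict (unitCube 0)) (x₀ := (0 : ℝ)) (s := univ)
    (F := fun t θ => mFourier (-h) (toTorus θ) * (f (θ + t • w) : ℂ))
    (F' := fun t θ => mFourier (-h) (toTorus θ) * (f' (θ + t • w) : ℂ))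
    (bound := fun _ => M) Filter.univ_mem
    (Filter.Eventually.of_forall fun t => (hcont hc t).aestronglyMeasurable)
    (Integrable.of_bound (hcont hc 0).aestronglyMeasurable M0
      (Filter.Eventually.of_forall fun θ => by
        rw [norm_mul, norm_mFourier_toTorus, one_mul, Complex.norm_real]; exact hM0 _))
    (hcont hc' 0).aestronglyMeasurable
    (Filter.Eventually.of_forall fun θ t _ => by
      rw [norm_mul, norm_mFourier_toTorus, one_mul, Complex.norm_real]; exact hM _)
    (integrable_const _)
    (Filter.Eventually.of_forall fun θ t _ => by
      have h1 := hd (θ + t • w)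
      have h2 : HasDerivAt (fun r : ℝ => f (θ + r • w)) (f' (θ + t • w)) t := by
        have h3 : HasDerivAt (fun r : ℝ => f (θ + t • w + r • w)) (f' (θ + t • w)) (t + -t) := by
          rw [add_neg_cancel]; exact h1
        have h4 := h3.comp_add_const t (-t)
        refine h4.congr_of_eventuallyEq (Filter.Eventually.of_forall fun r => ?_)
        simp only
        congr 1
        module
      exact h2.ofReal_comp.const_mul _)
  have h5 := key.2
  simp only [hI] at h5
  have h6 : HasDerivAt (fun t : ℝ => Complex.exp (κ * t) * c) (κ * c) 0 := by
    have h7 : HasDerivAt (fun t : ℝ => κ * (t : ℂ)) κ 0 := by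
      simpa using ((hasDerivAt_id (0 : ℝ)).ofReal_comp).const_mul κ
    have h8 := (h7.cexp).mul_const c
    simpa using h8
  have h9 := h6.unique h5
  rw [h9, torusCoeff_eq_integral hc' hf' h 0]
  simp

end FourierAnalysis

/-! ### Coefficient decay and the error of a lattice rule. -/

section LatticeError

open MeasureTheory Set UnitAddTorus

variable {s : ℕ}

lemma torusCoeff_iterated {D : (Fin s → ℕ) → (Fin s → ℝ) → ℝ}
    (hD : ∀ ν j θ, HasLineDerivAt ℝ (D ν) (D (ν + Pi.single j 1) θ) θ (Pi.single j 1))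
    (hc : ∀ ν, Continuous (D ν)) (hp : ∀ ν j θ, D ν (θ + Pi.single j 1) = D ν θ)
    (h : Fin s → ℤ) (ν : Fin s → ℕ) :
    mFourierCoeff (torusLift (D ν) (hc ν) (hp ν)) h
      = (∏ j, (2 * Real.pi * Complex.I * h j) ^ ν j)
        * mFourierCoeff (torusLift (D 0) (hc 0) (hp 0)) h := by
  obtain ⟨n, hn⟩ : ∃ n, ∑ j, ν j = n := ⟨_, rfl⟩
  induction n generalizing ν with
  | zero =>
    have : ν = 0 := by
      ext j
      exact Finset.sum_eq_zero_iff.1 hn j (Finset.mem_univ j)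
    subst this
    simp
  | succ n ih =>
    obtain ⟨j, hj⟩ : ∃ j, ν j ≠ 0 := by
      by_contra hcon
      push Not at hcon
      simp [hcon] at hn
    obtain ⟨ν', rfl⟩ : ∃ ν' : Fin s → ℕ, ν = ν' + Pi.single j 1 := by
      refine ⟨fun i => ν i - (Pi.single j 1 : Fin s → ℕ) i, ?_⟩
      ext i
      rcases eq_or_ne i j with rfl | hij
      · simp only [Pi.add_apply, Pi.single_eq_same]; omega
      · simp only [Pi.add_apply, Pi.single_eq_of_ne hij]; omega
    have hn' : ∑ j, ν' j = n := by
      simp only [Pi.add_apply, Finset.sum_add_distrib, Finset.sum_pi_single', Finset.mem_univ,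
        if_true] at hn
      simpa using hn
    rw [torusCoeff_lineDeriv (hc ν') (hp ν') _ _ j (hD ν' j) h, ih ν' hn', ← mul_assoc]
    congr 1
    simp only [Pi.add_apply, pow_add, Finset.prod_mul_distrib]
    rw [mul_comm]
    congr 1
    rw [Finset.prod_eq_single j]
    · simp
    · intro i _ hij; simp [hij]
    · simp

/-- Decay of the Fourier coefficients from bounds on the derivatives of order `α` in the variables
in the support of the frequency. -/
lemma norm_torusCoeff_le_korobovCoeff {D : (Fin s → ℕ) → (Fin s → ℝ) → ℝ}
    (hD : ∀ ν j θ, HasLineDerivAt ℝ (D ν) (D (ν + Pi.single j 1) θ) θ (Pi.single j 1))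
    (hc : ∀ ν, Continuous (D ν)) (hp : ∀ ν j θ, D ν (θ + Pi.single j 1) = D ν θ)
    {α : ℕ} {K : ℝ} {γ : Finset (Fin s) → ℝ}
    (hb : ∀ (u : Finset (Fin s)) θ, |D (fun j => if j ∈ u then α else 0) θ|
        ≤ (2 * Real.pi) ^ (∑ j : Fin s, if j ∈ u then α else 0) * (K * γ u))
    (h : Fin s → ℤ) :
    ‖mFourierCoeff (torusLift (D 0) (hc 0) (hp 0)) h‖ ≤ K * korobovCoeff γ α h := by
  have hpi := Real.pi_pos
  -- The set u is matched to the frequency: differentiating α times exactly in supp h produces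
  -- (2π)^{α|u|} ∏ |h_j|^α. The power of 2π then cancels against the one in `hb`.
  have h1 := norm_torusCoeff_le (hc _) (hp _) (hb (freqSupp h)) h
  rw [torusCoeff_iterated hD hc hp, norm_mul, norm_prod] at h1
  have h2 : ∀ j, ‖(2 * Real.pi * Complex.I * h j : ℂ) ^ (if j ∈ freqSupp h then α else 0)‖
      = (2 * Real.pi) ^ (if j ∈ freqSupp h then α else 0)
        * (if j ∈ freqSupp h then |(h j : ℝ)| ^ α else 1) := by
    intro j
    split_ifs with hj
    · rw [norm_pow, ← mul_pow]
      congr 1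
      simp [abs_of_pos hpi]
    · simp
  simp_rw [h2] at h1
  rw [Finset.prod_mul_distrib, Finset.prod_pow_eq_pow_sum, mul_assoc] at h1
  have h3 := le_of_mul_le_mul_left h1 (by positivity)
  rw [Finset.prod_ite_mem, Finset.univ_inter] at h3
  have hP : 0 < ∏ j ∈ freqSupp h, |(h j : ℝ)| ^ α := by
    refine Finset.prod_pos fun j hj => ?_
    have : (h j : ℝ) ≠ 0 := by simpa [freqSupp] using hj
    positivity
  rw [korobovCoeff, Finset.prod_inv_distrib, ← mul_assoc, ← div_eq_mul_inv, le_div_iff₀ hP,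
    mul_comm]
  exact h3

lemma integral_Theta_eq {f : (Fin s → ℝ) → ℝ} (hc : Continuous f)
    (hf : ∀ j θ, f (θ + Pi.single j 1) = f θ) :
    ((∫ θ in Theta s, f θ : ℝ) : ℂ) = mFourierCoeff (torusLift f hc hf) 0 := by
  rw [torusCoeff_eq_integral hc hf 0 (fun _ => -(1 / 2)), ← integral_complex_ofReal]
  have h1 : unitCube (fun _ : Fin s => (-(1 / 2) : ℝ)) =ᵐ[volume] Theta s := by
    rw [unitCube_eq_pi, Theta]
    have := Measure.univ_pi_Ioc_ae_eq_Icc (μ := fun _ : Fin s => (volume : Measure ℝ))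
      (f := fun _ => (-(1 / 2) : ℝ)) (g := fun _ => 1 / 2)
    rw [← volume_pi] at this
    convert this using 4
    norm_num
  rw [setIntegral_congr_set h1]
  simp [mFourier_zero]

lemma sum_exp_eq {n : ℕ} (hn : 0 < n) (N : ℤ) :
    (1 / (n : ℂ)) * ∑ i ∈ Finset.Icc 1 n, Complex.exp (2 * Real.pi * Complex.I * (i * N / n))
      = if (n : ℤ) ∣ N then 1 else 0 := by
  have hn0 : (n : ℂ) ≠ 0 := by exact_mod_cast hn.ne'
  set r : ℂ := Complex.exp (2 * Real.pi * Complex.I * (N / n)) with hr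
  have hterm : ∀ i : ℕ, Complex.exp (2 * Real.pi * Complex.I * (i * N / n)) = r ^ i := by
    intro i
    rw [hr, ← Complex.exp_nat_mul]
    congr 1; ring
  have hrn : r ^ n = 1 := by
    rw [← hterm]
    rw [Complex.exp_eq_one_iff]
    exact ⟨N, by field_simp⟩
  simp_rw [hterm]
  have hsum : ∑ i ∈ Finset.Icc 1 n, r ^ i = r * ∑ i ∈ Finset.range n, r ^ i := by
    rw [← Finset.Ico_add_one_right_eq_Icc, Finset.sum_Ico_eq_sum_range, Finset.mul_sum]
    simp [pow_add]
  rw [hsum]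
  have hr1 : r = 1 ↔ (n : ℤ) ∣ N := by
    rw [hr, Complex.exp_eq_one_iff]
    have h2 : (2 * Real.pi * Complex.I : ℂ) ≠ 0 := Complex.two_pi_I_ne_zero
    constructor
    · rintro ⟨q, hq⟩
      rw [mul_comm (q : ℂ)] at hq
      have := mul_left_cancel₀ h2 hq
      rw [div_eq_iff hn0] at this
      exact ⟨q, by rw [mul_comm]; exact_mod_cast this⟩
    · rintro ⟨q, hq⟩
      refine ⟨q, ?_⟩
      rw [hq]; push_cast; field_simp
  split_ifs with hd
  · rw [hr1.2 hd]; simp [hn0]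
  · have h3 : r ≠ 1 := fun h => hd (hr1.1 h)
    rw [geom_sum_eq h3, hrn]; simp

/-- The error of a lattice rule is bounded by the sum over the dual lattice of bounds on the
Fourier coefficients. -/
lemma abs_integral_sub_latticeRule_le {f : (Fin s → ℝ) → ℝ} (hc : Continuous f)
    (hf : ∀ j θ, f (θ + Pi.single j 1) = f θ) {c : (Fin s → ℤ) → ℝ} (hcs : Summable c)
    (hfc : ∀ h, ‖mFourierCoeff (torusLift f hc hf) h‖ ≤ c h) {n : ℕ} (hn : 0 < n)
    (z : Fin s → ℕ) :
    |(∫ θ in Theta s, f θ) - latticeRule n z f|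
      ≤ ∑' h : {h : Fin s → ℤ // h ≠ 0 ∧ (n : ℤ) ∣ ∑ j, h j * (z j : ℤ)}, c h.1 := by
  set a := fun h => mFourierCoeff (torusLift f hc hf) h with ha
  have hn0 : (n : ℂ) ≠ 0 := by exact_mod_cast hn.ne'
  have hasum : Summable a := Summable.of_norm_bounded hcs hfc
  have hpt : ∀ θ, HasSum (fun h => a h * mFourier h (toTorus θ)) (f θ : ℂ) := by
    intro θ
    have := hasSum_mFourier_series_apply_of_summable hasum (toTorus θ)
    rw [torusLift_toTorus] at this
    exact this
  have hper : ∀ (h : Fin s → ℤ) (i : ℕ), mFourier h (toTorus (latticePoint n z i))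
      = Complex.exp (2 * Real.pi * Complex.I * (i * ((∑ j, h j * (z j : ℤ) : ℤ) : ℂ) / n)) := by
    intro h i
    have h1 : toTorus (latticePoint n z i) = toTorus fun j => (i : ℝ) * (z j : ℝ) / n := by
      ext j
      simp only [toTorus, latticePoint, Int.fract]
      rw [AddCircle.coe_sub, sub_eq_self]
      exact AddCircle.coe_eq_zero_iff 1 |>.2 ⟨⌊(i : ℝ) * (z j : ℝ) / n⌋, by simp⟩
    rw [h1, mFourier_toTorus]
    congr 2
    push_cast
    rw [Finset.mul_sum, Finset.sum_div]
    exact Finset.sum_congr rfl fun j _ => by ring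
  have hrule : HasSum (fun h => a h * if (n : ℤ) ∣ ∑ j, h j * (z j : ℤ) then 1 else 0)
      ((latticeRule n z f : ℝ) : ℂ) := by
    have h1 := (hasSum_sum fun i (_ : i ∈ Finset.Icc 1 n) => hpt (latticePoint n z i)).mul_left
      (1 / (n : ℂ))
    have h2 : ((latticeRule n z f : ℝ) : ℂ)
        = 1 / (n : ℂ) * ∑ i ∈ Finset.Icc 1 n, (f (latticePoint n z i) : ℂ) := by
      simp [latticeRule]
    rw [h2]
    refine h1.congr_fun fun h => ?_
    rw [← sum_exp_eq hn, ← Finset.mul_sum]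
    simp_rw [hper]
    ring
  have h0 : HasSum (fun h : Fin s → ℤ => if h = 0 then a 0 else 0) ((∫ θ in Theta s, f θ : ℝ) : ℂ) := by
    rw [integral_Theta_eq hc hf]
    exact hasSum_ite_eq 0 (a 0)
  have hdiff := hrule.sub h0
  have hbound : ∀ h, ‖a h * (if (n : ℤ) ∣ ∑ j, h j * (z j : ℤ) then 1 else 0)
      - (if h = 0 then a 0 else 0)‖
      ≤ Set.indicator {h : Fin s → ℤ | h ≠ 0 ∧ (n : ℤ) ∣ ∑ j, h j * (z j : ℤ)} c h := by
    intro h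
    by_cases hh : h = 0
    · subst hh
      simp
    · by_cases hd : (n : ℤ) ∣ ∑ j, h j * (z j : ℤ)
      · simp [hh, hd]; exact hfc h
      · simp [hh, hd]
  have h3 := tsum_of_norm_bounded (hcs.indicator _).hasSum hbound
  rw [hdiff.tsum_eq, ← tsum_subtype] at h3
  rw [← Complex.ofReal_sub, Complex.norm_real, Real.norm_eq_abs, abs_sub_comm] at h3
  exact h3

end LatticeError

/-! ### Subadditivity, product sums over supports, and gcd-weighted sums. -/

section ENNRealSums

open scoped ENNReal

lemma ENNReal.rpow_finsetSum_le {ι : Type*} (t : Finset ι) (a : ι → ℝ≥0∞) {p : ℝ} (hp0 : 0 < p)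
    (hp1 : p ≤ 1) : (∑ i ∈ t, a i) ^ p ≤ ∑ i ∈ t, a i ^ p := by
  classical
  induction t using Finset.induction_on with
  | empty => simp [hp0]
  | insert i t hi ih =>
    rw [Finset.sum_insert hi, Finset.sum_insert hi]
    exact (ENNReal.rpow_add_le_add_rpow _ _ hp0.le hp1).trans (add_le_add_right ih _)

lemma ENNReal.rpow_tsum_le {ι : Type*} (a : ι → ℝ≥0∞) {p : ℝ} (hp0 : 0 < p) (hp1 : p ≤ 1) :
    (∑' i, a i) ^ p ≤ ∑' i, a i ^ p := by
  rw [← ENNReal.le_rpow_inv_iff hp0, ENNReal.tsum_eq_iSup_sum (f := a)]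
  refine iSup_le fun t => ?_
  rw [ENNReal.le_rpow_inv_iff hp0]
  exact (ENNReal.rpow_finsetSum_le t a hp0 hp1).trans (ENNReal.sum_le_tsum t)

lemma ENNReal.tsum_pi_prod {s : ℕ} {ι : Type*} (f : Fin s → ι → ℝ≥0∞) :
    ∑' h : Fin s → ι, ∏ j, f j (h j) = ∏ j, ∑' i, f j i := by
  induction s with
  | zero => simp
  | succ s ih =>
    rw [← (Fin.consEquiv fun _ : Fin (s + 1) => ι).tsum_eq, ENNReal.tsum_prod', Fin.prod_univ_succ,
      ← ih (fun j => f j.succ), ← ENNReal.tsum_mul_right]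
    refine tsum_congr fun a => ?_
    rw [← ENNReal.tsum_mul_left]
    refine tsum_congr fun h => ?_
    rw [Fin.prod_univ_succ]
    simp [Fin.consEquiv]

/-- The sum of a product weight over the frequencies with a given support. -/
lemma tsum_freqSupp_eq {s : ℕ} (w : ℤ → ℝ≥0∞) (hw : w 0 = 0) (u : Finset (Fin s)) :
    ∑' h : Fin s → ℤ, (if freqSupp h = u then ∏ j ∈ u, w (h j) else 0) = (∑' k, w k) ^ u.card := by
  have h1 : ∀ h : Fin s → ℤ, (if freqSupp h = u then ∏ j ∈ u, w (h j) else 0)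
      = ∏ j, (if j ∈ u then w (h j) else if h j = 0 then 1 else 0) := by
    intro h
    split_ifs with hu
    · rw [← Finset.prod_subset (Finset.subset_univ u)]
      · exact Finset.prod_congr rfl fun j hj => by rw [if_pos hj]
      · intro j _ hj
        rw [if_neg hj, if_pos]
        rw [← hu] at hj
        simpa [freqSupp] using hj
    · obtain ⟨j, hj⟩ : ∃ j, ¬ (j ∈ freqSupp h ↔ j ∈ u) := by
        by_contra hcon
        push Not at hcon
        exact hu (Finset.ext hcon)
      refine (Finset.prod_eq_zero (Finset.mem_univ j) ?_).symm
      simp only [freqSupp, Finset.mem_filter, Finset.mem_univ, true_and] at hj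
      by_cases hju : j ∈ u
      · have : h j = 0 := by tauto
        rw [if_pos hju, this, hw]
      · have : h j ≠ 0 := by tauto
        rw [if_neg hju, if_neg this]
  simp_rw [h1]
  rw [ENNReal.tsum_pi_prod fun j k => if j ∈ u then w k else if k = 0 then 1 else 0]
  have h2 : ∀ j, (∑' k : ℤ, if j ∈ u then w k else if k = 0 then 1 else 0)
      = if j ∈ u then ∑' k, w k else 1 := by
    intro j
    split_ifs
    · rfl
    · exact tsum_ite_eq 0 _
  simp_rw [h2]
  rw [Finset.prod_ite_mem, Finset.univ_inter, Finset.prod_const]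

lemma tsum_mul_freqSupp {s : ℕ} (w : ℤ → ℝ≥0∞) (hw : w 0 = 0) (g : Finset (Fin s) → ℝ≥0∞) :
    ∑' h : Fin s → ℤ, g (freqSupp h) * ∏ j ∈ freqSupp h, w (h j)
      = ∑ u, g u * (∑' k, w k) ^ u.card := by
  have h1 : ∀ h : Fin s → ℤ, g (freqSupp h) * ∏ j ∈ freqSupp h, w (h j)
      = ∑ u, g u * (if freqSupp h = u then ∏ j ∈ u, w (h j) else 0) := by
    intro h
    rw [Finset.sum_eq_single (freqSupp h)]
    · simp
    · intro u _ hu; rw [if_neg hu.symm, mul_zero]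
    · simp
  simp_rw [h1]
  rw [Summable.tsum_finsetSum fun _ _ => ENNReal.summable]
  refine Finset.sum_congr rfl fun u _ => ?_
  rw [ENNReal.tsum_mul_left, tsum_freqSupp_eq w hw u]

lemma tsum_abs_rpow_ne_top {t : ℝ} (ht : 1 < t) :
    ∑' k : ℤ, ENNReal.ofReal (|(k : ℝ)| ^ (-t)) ≠ ⊤ :=
  (Real.summable_abs_int_rpow ht).tsum_ofReal_ne_top

/-- The sums of `gcd(k, 2^m) |k|^{-t}` are bounded uniformly in `m`. -/
lemma exists_bound_tsum_gcd {t : ℝ} (ht : 1 < t) :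
    ∃ c : ℝ, 1 ≤ c ∧ ∀ m : ℕ, ∑' k : ℤ, ENNReal.ofReal (|(k : ℝ)| ^ (-t))
      * (Int.gcd k (2 ^ m : ℕ) : ℝ≥0∞) ≤ ENNReal.ofReal c := by
  set Z := ∑' k : ℤ, ENNReal.ofReal (|(k : ℝ)| ^ (-t)) with hZ
  have hZt : Z ≠ ⊤ := tsum_abs_rpow_ne_top ht
  set r : ℝ≥0∞ := ENNReal.ofReal (2 ^ (1 - t)) with hr
  have hr1 : r < 1 := by
    rw [hr, ENNReal.ofReal_lt_one]
    exact Real.rpow_lt_one_of_one_lt_of_neg (by norm_num) (by linarith)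
  set B := (1 - r)⁻¹ * Z with hB
  have hBt : B ≠ ⊤ := ENNReal.mul_ne_top (ENNReal.inv_ne_top.2 (tsub_pos_of_lt hr1).ne') hZt
  -- The added 1 gives c ≥ 1, which later allows c^{|u|} ≤ c^{|m|}.
  refine ⟨B.toReal + 1, by linarith [B.toReal_nonneg], fun m => ?_⟩
  -- A divisor of 2^m is a power 2^i, so the gcd is one term of the sum of all 2^i dividing k. That
  -- sum no longer involves m, and exchanging summations leaves a geometric series of ratio 2^{1-t}
  -- < 1.
  have hle : ∀ k : ℤ, (Int.gcd k (2 ^ m : ℕ) : ℝ≥0∞)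
      ≤ ∑' i : ℕ, if ((2 ^ i : ℕ) : ℤ) ∣ k then ((2 ^ i : ℕ) : ℝ≥0∞) else 0 := by
    intro k
    have h1 : Int.gcd k (2 ^ m : ℕ) ∣ 2 ^ m := by
      exact_mod_cast Int.gcd_dvd_right k ((2 ^ m : ℕ) : ℤ)
    obtain ⟨i, -, hi⟩ := (Nat.dvd_prime_pow Nat.prime_two).1 h1
    have h2 : ((2 ^ i : ℕ) : ℤ) ∣ k := by rw [← hi]; exact Int.gcd_dvd_left _ _
    rw [hi]
    refine le_trans ?_ (ENNReal.le_tsum i)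
    rw [if_pos h2]
  calc ∑' k : ℤ, ENNReal.ofReal (|(k : ℝ)| ^ (-t)) * (Int.gcd k (2 ^ m : ℕ) : ℝ≥0∞)
      ≤ ∑' k : ℤ, ENNReal.ofReal (|(k : ℝ)| ^ (-t))
          * ∑' i : ℕ, (if ((2 ^ i : ℕ) : ℤ) ∣ k then ((2 ^ i : ℕ) : ℝ≥0∞) else 0) :=
        ENNReal.tsum_le_tsum fun k => by gcongr; exact hle k
    _ = ∑' i : ℕ, ∑' k : ℤ, ENNReal.ofReal (|(k : ℝ)| ^ (-t))
          * (if ((2 ^ i : ℕ) : ℤ) ∣ k then ((2 ^ i : ℕ) : ℝ≥0∞) else 0) := by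
        simp_rw [← ENNReal.tsum_mul_left]
        exact ENNReal.tsum_comm
    _ = ∑' i : ℕ, r ^ i * Z := by
        refine tsum_congr fun i => ?_
        have hinj : Function.Injective fun k : ℤ => ((2 ^ i : ℕ) : ℤ) * k :=
          mul_right_injective₀ (by positivity)
        rw [← hinj.tsum_eq]
        · rw [hZ, ← ENNReal.tsum_mul_left]
          refine tsum_congr fun k => ?_
          rw [if_pos (Dvd.intro _ rfl)]
          have h3 : |(((2 ^ i : ℕ) : ℤ) * k : ℤ)| = (2 ^ i : ℤ) * |k| := by
            rw [abs_mul]; simp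
          have h4 : |(((((2 ^ i : ℕ) : ℤ) * k : ℤ)) : ℝ)| ^ (-t)
              = ((2 : ℝ) ^ i) ^ (-t) * |(k : ℝ)| ^ (-t) := by
            rw [← Real.mul_rpow (by positivity) (abs_nonneg _)]
            congr 1
            push_cast
            rw [abs_mul]
            simp
          have h5 : r ^ i = ENNReal.ofReal (((2 : ℝ) ^ i) ^ (-t)) * ((2 ^ i : ℕ) : ℝ≥0∞) := by
            rw [← ENNReal.ofReal_natCast, ← ENNReal.ofReal_mul (by positivity), hr,
              ← ENNReal.ofReal_pow (by positivity)]
            congr 1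
            rw [sub_eq_add_neg, Real.rpow_add (by norm_num), Real.rpow_one, mul_pow,
              ← Real.rpow_natCast (2 ^ (-t)), ← Real.rpow_mul (by norm_num), ← Real.rpow_natCast 2 i,
              ← Real.rpow_mul (by norm_num)]
            push_cast
            rw [mul_comm, mul_comm (-t)]
            simp
          rw [h4, ENNReal.ofReal_mul (by positivity), h5]
          ring
        · intro k hk
          simp only [Function.mem_support, ne_eq, mul_eq_zero, not_or, ite_eq_right_iff,
            Classical.not_imp] at hk
          obtain ⟨q, hq⟩ := hk.2.1
          exact ⟨q, hq.symm⟩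
    _ = B := by rw [ENNReal.tsum_mul_right, ENNReal.tsum_geometric]
    _ ≤ ENNReal.ofReal (B.toReal + 1) := by
        rw [← ENNReal.ofReal_toReal hBt]
        exact ENNReal.ofReal_le_ofReal (by simp)

end ENNRealSums

/-! ### The averaging argument for the component-by-component construction. -/

section CBC

open scoped ENNReal

variable {s : ℕ}

lemma korobovCoeff_nonneg {γ : Finset (Fin s) → ℝ} (hγ : ∀ u, 0 ≤ γ u) (α : ℕ) (h : Fin s → ℤ) :
    0 ≤ korobovCoeff γ α h :=
  mul_nonneg (hγ _) (Finset.prod_nonneg fun j _ => by positivity)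

lemma ofReal_korobovCoeff_rpow {γ : Finset (Fin s) → ℝ} (hγ : ∀ u, 0 ≤ γ u) (α : ℕ) {p : ℝ}
    (hp : 0 ≤ p) (h : Fin s → ℤ) :
    ENNReal.ofReal (korobovCoeff γ α h) ^ p = ENNReal.ofReal (γ (freqSupp h) ^ p)
      * ∏ j ∈ freqSupp h, ENNReal.ofReal (|(h j : ℝ)| ^ (-(α * p))) := by
  rw [korobovCoeff, ENNReal.ofReal_mul (hγ _), ENNReal.mul_rpow_of_nonneg _ _ hp,
    ENNReal.ofReal_prod_of_nonneg (fun j _ => by positivity), ← ENNReal.prod_rpow_of_nonneg hp,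
    ENNReal.ofReal_rpow_of_nonneg (hγ _) hp]
  congr 1
  refine Finset.prod_congr rfl fun j _ => ?_
  rw [ENNReal.ofReal_rpow_of_nonneg (by positivity) hp, ← Real.rpow_natCast, ← Real.rpow_neg
    (abs_nonneg _), ← Real.rpow_mul (abs_nonneg _), neg_mul]

lemma ofReal_abs_zero_rpow {t : ℝ} (ht : 1 < t) :
    ENNReal.ofReal (|((0 : ℤ) : ℝ)| ^ (-t)) = 0 := by
  rw [Int.cast_zero, abs_zero, Real.zero_rpow (by linarith), ENNReal.ofReal_zero]

lemma tsum_korobovCoeff_ne_top {γ : Finset (Fin s) → ℝ} (hγ : ∀ u, 0 ≤ γ u) {α : ℕ} (hα : 2 ≤ α) :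
    ∑' h, ENNReal.ofReal (korobovCoeff γ α h) ≠ ⊤ := by
  have hα1 : (1 : ℝ) < α * 1 := by rw [mul_one]; exact_mod_cast hα
  have h1 : ∀ h, ENNReal.ofReal (korobovCoeff γ α h) = ENNReal.ofReal (γ (freqSupp h))
      * ∏ j ∈ freqSupp h, ENNReal.ofReal (|(h j : ℝ)| ^ (-(α * 1 : ℝ))) := by
    intro h
    have := ofReal_korobovCoeff_rpow hγ α zero_le_one h
    rwa [ENNReal.rpow_one, Real.rpow_one] at this
  simp_rw [h1]
  rw [tsum_mul_freqSupp (fun k => ENNReal.ofReal (|(k : ℝ)| ^ (-(α * 1 : ℝ))))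
    (ofReal_abs_zero_rpow hα1) (fun u => ENNReal.ofReal (γ u))]
  exact ENNReal.sum_ne_top.2 fun u _ => ENNReal.mul_ne_top ENNReal.ofReal_ne_top
    (ENNReal.pow_ne_top (tsum_abs_rpow_ne_top hα1))

lemma summable_korobovCoeff {γ : Finset (Fin s) → ℝ} (hγ : ∀ u, 0 ≤ γ u) {α : ℕ} (hα : 2 ≤ α) :
    Summable (korobovCoeff γ α) := by
  refine (ENNReal.summable_toReal (tsum_korobovCoeff_ne_top hγ hα)).congr fun h => ?_
  rw [ENNReal.toReal_ofReal (korobovCoeff_nonneg hγ α h)]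

open Classical in
/-- The part of the worst-case error due to the dual frequencies whose last nonzero component is
at position `d`. -/
noncomputable def lastSum (n : ℕ) (γ : Finset (Fin s) → ℝ) (α : ℕ) (d : Fin s) (z : Fin s → ℕ) :
    ℝ≥0∞ :=
  ∑' h : Fin s → ℤ, if (h d ≠ 0 ∧ ∀ j, d < j → h j = 0) ∧ (n : ℤ) ∣ ∑ j, h j * (z j : ℤ)
    then ENNReal.ofReal (korobovCoeff γ α h) else 0

open Classical in
/-- The part of the worst-case error due to the dual frequencies supported strictly before `d`. -/
noncomputable def headSum (n : ℕ) (γ : Finset (Fin s) → ℝ) (α : ℕ) (d : Fin s) (z : Fin s → ℕ) :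
    ℝ≥0∞ :=
  ∑' h : Fin s → ℤ, if (h ≠ 0 ∧ h d = 0 ∧ ∀ j, d < j → h j = 0) ∧
    (n : ℤ) ∣ ∑ j, h j * (z j : ℤ) then ENNReal.ofReal (korobovCoeff γ α h) else 0

open Classical in
lemma ofReal_cbcError {γ : Finset (Fin s) → ℝ} (hγ : ∀ u, 0 ≤ γ u) {α : ℕ} (hα : 2 ≤ α) (n : ℕ)
    (d : Fin s) (z : Fin s → ℕ) :
    ENNReal.ofReal (cbcError n γ α d z) = headSum n γ α d z + lastSum n γ α d z := by
  have h1 : ENNReal.ofReal (cbcError n γ α d z)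
      = ∑' h : {h : Fin s → ℤ | h ≠ 0 ∧ (∀ j, d < j → h j = 0) ∧
          (n : ℤ) ∣ ∑ j, h j * (z j : ℤ)}, ENNReal.ofReal (korobovCoeff γ α h) :=
    ENNReal.ofReal_tsum_of_nonneg (fun h => korobovCoeff_nonneg hγ α h.1)
      ((summable_korobovCoeff hγ hα).subtype _)
  have h2 := ENNReal.tsum_add
    (f := fun h : Fin s → ℤ => if (h ≠ 0 ∧ h d = 0 ∧ ∀ j, d < j → h j = 0) ∧
      (n : ℤ) ∣ ∑ j, h j * (z j : ℤ) then ENNReal.ofReal (korobovCoeff γ α h) else 0)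
    (g := fun h : Fin s → ℤ => if (h d ≠ 0 ∧ ∀ j, d < j → h j = 0) ∧
      (n : ℤ) ∣ ∑ j, h j * (z j : ℤ) then ENNReal.ofReal (korobovCoeff γ α h) else 0)
  have h3 : headSum n γ α d z + lastSum n γ α d z = _ := h2.symm
  rw [h1, h3, tsum_subtype _ (fun h => ENNReal.ofReal (korobovCoeff γ α h))]
  refine tsum_congr fun h => ?_
  rw [Set.indicator_apply]
  by_cases h0 : h = 0
  · subst h0; simp
  by_cases hd : h d = 0
  · rw [if_neg (c := (h d ≠ 0 ∧ _) ∧ _) (fun hh => hh.1.1 hd), add_zero]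
    exact if_congr (by rw [Set.mem_ofPred_eq]; tauto) rfl rfl
  · rw [if_neg (c := (h ≠ 0 ∧ h d = 0 ∧ _) ∧ _) (fun hh => hd hh.1.2.1), zero_add]
    exact if_congr (by rw [Set.mem_ofPred_eq]; tauto) rfl rfl

lemma headSum_ne_top {γ : Finset (Fin s) → ℝ} (hγ : ∀ u, 0 ≤ γ u) {α : ℕ} (hα : 2 ≤ α) (n : ℕ)
    (d : Fin s) (z : Fin s → ℕ) : headSum n γ α d z ≠ ⊤ := by
  refine ne_top_of_le_ne_top (tsum_korobovCoeff_ne_top hγ hα) (ENNReal.tsum_le_tsum fun h => ?_)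
  split_ifs <;> simp

lemma headSum_update (n : ℕ) (γ : Finset (Fin s) → ℝ) (α : ℕ) (d : Fin s) (z : Fin s → ℕ) (w : ℕ) :
    headSum n γ α d (Function.update z d w) = headSum n γ α d z := by
  refine tsum_congr fun h => ?_
  by_cases hd : h d = 0
  · have : ∑ j, h j * ((Function.update z d w j : ℕ) : ℤ) = ∑ j, h j * (z j : ℤ) := by
      refine Finset.sum_congr rfl fun j _ => ?_
      rcases eq_or_ne j d with rfl | hj
      · simp [hd]
      · rw [Function.update_of_ne hj]
    rw [this]
  · simp [hd]

/-- The head part of the error does not depend on z_d and is finite, so it cancels: minimizing the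
whole error minimizes the part that involves h_d ≠ 0. -/
lemma lastSum_le_update {γ : Finset (Fin s) → ℝ} (hγ : ∀ u, 0 ≤ γ u) {α : ℕ} (hα : 2 ≤ α) {n : ℕ}
    {z : Fin s → ℕ} (hz : IsCBCVector n γ α z) (d : Fin s) {w : ℕ} (hw : w ∈ cbcCandidates n) :
    lastSum n γ α d z ≤ lastSum n γ α d (Function.update z d w) := by
  have h1 := ENNReal.ofReal_le_ofReal ((hz d).2 w hw)
  rw [ofReal_cbcError hγ hα, ofReal_cbcError hγ hα, headSum_update] at h1
  exact (ENNReal.add_le_add_iff_left (headSum_ne_top hγ hα n d z)).1 h1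

/-- A linear congruence `a + b w ≡ 0` modulo `n` has at most `gcd(b, n)` solutions. -/
lemma card_congruence_le {n : ℕ} (hn : 0 < n) (a b : ℤ) (t : Finset ℕ) (ht : t ⊆ Finset.Icc 1 n) :
    (t.filter fun w : ℕ => (n : ℤ) ∣ a + b * (w : ℤ)).card ≤ Int.gcd b n := by
  set g := Int.gcd b n with hg
  have hg0 : 0 < g := Int.gcd_pos_of_ne_zero_right _ (by positivity)
  obtain ⟨q, hq⟩ : g ∣ n := by exact_mod_cast Int.gcd_dvd_right b (n : ℤ)
  have hq0 : 0 < q := Nat.pos_of_ne_zero (by rintro rfl; simp at hq; omega)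
  rw [← Finset.card_range g]
  -- Two solutions agree modulo q = n/g, so at most one lies in each of the g consecutive blocks of
  -- length q. The shift by 1 is due to the range starting at 1.
  refine Finset.card_le_card_of_injOn (fun w => (w - 1) / q) ?_ ?_
  · intro w hw
    have hw' := Finset.mem_Icc.1 (ht (Finset.mem_filter.1 hw).1)
    rw [Finset.coe_range, Set.mem_Iio, Nat.div_lt_iff_lt_mul hq0, ← hq]
    omega
  · intro w hw w' hw' heq
    have h1 := (Finset.mem_filter.1 hw)
    have h2 := (Finset.mem_filter.1 hw')
    have hb1 := Finset.mem_Icc.1 (ht h1.1)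
    have hb2 := Finset.mem_Icc.1 (ht h2.1)
    have hd : (n : ℤ) ∣ b * ((w : ℤ) - w') := by
      rw [show b * ((w : ℤ) - w') = (a + b * w) - (a + b * w') by ring]
      exact dvd_sub h1.2 h2.2
    have hdq : (q : ℤ) ∣ (w : ℤ) - w' := by
      obtain ⟨b', hb'⟩ : (g : ℤ) ∣ b := Int.gcd_dvd_left _ _
      have hcop : IsCoprime (q : ℤ) b' := by
        rw [Int.isCoprime_iff_gcd_eq_one]
        have h3 : Int.gcd ((g : ℤ) * b') ((g : ℤ) * q) = g := by
          rw [← hb']; rw [hg]; congr 1; exact_mod_cast hq.symm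
        rw [Int.gcd_mul_left, Int.natAbs_natCast] at h3
        rw [Int.gcd_comm]
        exact Nat.eq_of_mul_eq_mul_left hg0 (by rw [h3, mul_one])
      rw [hb', hq] at hd
      push_cast at hd
      rw [mul_assoc] at hd
      exact hcop.dvd_of_dvd_mul_left (Int.dvd_of_mul_dvd_mul_left (by positivity) hd)
    simp only at heq
    have h3 : ((w - 1 : ℕ) : ℤ) % q = ((w' - 1 : ℕ) : ℤ) % q := by
      rw [Int.emod_emod_of_dvd _ dvd_rfl |>.symm]
      apply Int.emod_emod_of_dvd _ dvd_rfl |>.trans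
      apply Int.ModEq.symm
      rw [Int.modEq_iff_dvd]
      rw [Nat.cast_sub hb1.1, Nat.cast_sub hb2.1]
      simpa using hdq
    have h4 : (w - 1) % q = (w' - 1) % q := by exact_mod_cast h3
    have h5 := Nat.div_add_mod (w - 1) q
    have h6 := Nat.div_add_mod (w' - 1) q
    rw [heq, h4, h6] at h5
    omega

/-- The weight appearing in the averaging argument. -/
noncomputable def gcdWeight (n : ℕ) (t : ℝ) (k : ℤ) : ℝ≥0∞ :=
  ENNReal.ofReal (|(k : ℝ)| ^ (-t)) * (Int.gcd k n : ℝ≥0∞)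

open Classical in
/-- The averaging argument: a minimizer is at least as good as the mean over all candidates. -/
lemma card_mul_lastSum_rpow_le {γ : Finset (Fin s) → ℝ} (hγ : ∀ u, 0 ≤ γ u) {α : ℕ} (hα : 2 ≤ α)
    {p : ℝ} (hp0 : 0 < p) (hp1 : p ≤ 1) (hαp : 1 < α * p) {n : ℕ} (hn : 0 < n)
    {z : Fin s → ℕ} (hz : IsCBCVector n γ α z) (d : Fin s) :
    (cbcCandidates n).card * lastSum n γ α d z ^ p
      ≤ ∑ u : Finset (Fin s), (if d ∈ u ∧ ∀ j, d < j → j ∉ u then ENNReal.ofReal (γ u ^ p) else 0)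
          * (∑' k, gcdWeight n (α * p) k) ^ u.card := by
  have hsub : cbcCandidates n ⊆ Finset.Icc 1 n := Finset.filter_subset _ _
  calc (cbcCandidates n).card * lastSum n γ α d z ^ p
      = ∑ w ∈ cbcCandidates n, lastSum n γ α d z ^ p := by
        rw [Finset.sum_const, nsmul_eq_mul]
    _ ≤ ∑ w ∈ cbcCandidates n, ∑' h : Fin s → ℤ, (if (h d ≠ 0 ∧ ∀ j, d < j → h j = 0) ∧
          (n : ℤ) ∣ ∑ j, h j * ((Function.update z d w j : ℕ) : ℤ)
          then ENNReal.ofReal (korobovCoeff γ α h) ^ p else 0) := by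
        refine Finset.sum_le_sum fun w hw => ?_
        -- The p-th power is moved inside the sum over h before averaging. This gives the rate
        -- n^{-1/p} when the power is undone, at the price of needing αp > 1.
        refine (ENNReal.rpow_le_rpow (lastSum_le_update hγ hα hz d hw) hp0.le).trans ?_
        refine (ENNReal.rpow_tsum_le _ hp0 hp1).trans (le_of_eq (tsum_congr fun h => ?_))
        split_ifs
        · rfl
        · exact ENNReal.zero_rpow_of_pos hp0
    _ = ∑' h : Fin s → ℤ, ∑ w ∈ cbcCandidates n, (if (h d ≠ 0 ∧ ∀ j, d < j → h j = 0) ∧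
          (n : ℤ) ∣ ∑ j, h j * ((Function.update z d w j : ℕ) : ℤ)
          then ENNReal.ofReal (korobovCoeff γ α h) ^ p else 0) :=
        (Summable.tsum_finsetSum fun _ _ => ENNReal.summable).symm
    _ ≤ ∑' h : Fin s → ℤ, (if d ∈ freqSupp h ∧ ∀ j, d < j → j ∉ freqSupp h
          then ENNReal.ofReal (γ (freqSupp h) ^ p) else 0)
          * ∏ j ∈ freqSupp h, gcdWeight n (α * p) (h j) := by
        refine ENNReal.tsum_le_tsum fun h => ?_
        by_cases hcond : h d ≠ 0 ∧ ∀ j, d < j → h j = 0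
        · have hcond' : d ∈ freqSupp h ∧ ∀ j, d < j → j ∉ freqSupp h := by
            simpa [freqSupp] using hcond
          rw [if_pos hcond']
          have hsum : ∀ w : ℕ, ∑ j, h j * ((Function.update z d w j : ℕ) : ℤ)
              = (∑ j ∈ Finset.univ.erase d, h j * (z j : ℤ)) + h d * (w : ℤ) := by
            intro w
            rw [← Finset.sum_erase_add _ _ (Finset.mem_univ d), Function.update_self]
            congr 1
            refine Finset.sum_congr rfl fun j hj => ?_
            rw [Function.update_of_ne (Finset.ne_of_mem_erase hj)]
          simp only [hsum, and_iff_right hcond]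
          rw [← Finset.sum_filter, Finset.sum_const, nsmul_eq_mul,
            ofReal_korobovCoeff_rpow hγ α hp0.le]
          have hcard := card_congruence_le hn (∑ j ∈ Finset.univ.erase d, h j * (z j : ℤ)) (h d)
            (cbcCandidates n) hsub
          -- Only gcd(h_d, n) counts solutions. Including the other gcds, each at least 1, gives a
          -- product over the support, so the sum over h factorizes.
          have hprod : (Int.gcd (h d) n : ℝ≥0∞) ≤ ∏ j ∈ freqSupp h, (Int.gcd (h j) n : ℝ≥0∞) := by
            rw [← Finset.mul_prod_erase _ _ hcond'.1]
            refine le_mul_of_one_le_right (zero_le) ?_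
            refine Finset.one_le_prod' fun j _ => ?_
            have : 0 < Int.gcd (h j) n := Int.gcd_pos_of_ne_zero_right _ (by positivity)
            exact_mod_cast this
          calc _ ≤ (∏ j ∈ freqSupp h, (Int.gcd (h j) n : ℝ≥0∞))
                * (ENNReal.ofReal (γ (freqSupp h) ^ p)
                  * ∏ j ∈ freqSupp h, ENNReal.ofReal (|(h j : ℝ)| ^ (-(α * p)))) := by
                gcongr
                refine le_trans ?_ hprod
                exact_mod_cast hcard
            _ = _ := by
                simp only [gcdWeight]
                rw [Finset.prod_mul_distrib]
                ring
        · simp only [hcond, false_and, if_false, Finset.sum_const_zero]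
          exact zero_le
    _ = _ := tsum_mul_freqSupp (gcdWeight n (α * p))
        (by rw [gcdWeight, ofReal_abs_zero_rpow hαp, zero_mul])
        (fun u => if d ∈ u ∧ ∀ j, d < j → j ∉ u then ENNReal.ofReal (γ u ^ p) else 0)

open Classical in
-- Every nonzero frequency is counted at the position of its last nonzero component.
lemma dualSum_le_sum_lastSum (n : ℕ) (γ : Finset (Fin s) → ℝ) (α : ℕ) (z : Fin s → ℕ) :
    ∑' h : Fin s → ℤ, (if h ≠ 0 ∧ (n : ℤ) ∣ ∑ j, h j * (z j : ℤ)
      then ENNReal.ofReal (korobovCoeff γ α h) else 0) ≤ ∑ d, lastSum n γ α d z := by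
  simp only [lastSum]
  rw [← Summable.tsum_finsetSum fun _ _ => ENNReal.summable]
  refine ENNReal.tsum_le_tsum fun h => ?_
  by_cases hh : h ≠ 0 ∧ (n : ℤ) ∣ ∑ j, h j * (z j : ℤ)
  · rw [if_pos hh]
    have hne : (freqSupp h).Nonempty := by
      obtain ⟨j, hj⟩ := Function.ne_iff.1 hh.1
      exact ⟨j, by simpa [freqSupp] using hj⟩
    have hmem := (freqSupp h).max'_mem hne
    refine le_trans ?_ (Finset.single_le_sum (fun _ _ => zero_le)
      (Finset.mem_univ ((freqSupp h).max' hne)))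
    rw [if_pos]
    refine ⟨⟨by simpa [freqSupp] using hmem, fun j hj => ?_⟩, hh.2⟩
    by_contra hcon
    exact absurd ((freqSupp h).le_max' j (by simpa [freqSupp] using hcon)) (not_le.2 hj)
  · rw [if_neg hh]
    exact zero_le

open Classical in
/-- The worst-case error bound for vectors constructed component by component. -/
lemma card_mul_dualSum_rpow_le {γ : Finset (Fin s) → ℝ} (hγ : ∀ u, 0 ≤ γ u) {α : ℕ} (hα : 2 ≤ α)
    {p : ℝ} (hp0 : 0 < p) (hp1 : p ≤ 1) (hαp : 1 < α * p) {n : ℕ} (hn : 0 < n)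
    {z : Fin s → ℕ} (hz : IsCBCVector n γ α z) :
    (cbcCandidates n).card * (∑' h : Fin s → ℤ, (if h ≠ 0 ∧ (n : ℤ) ∣ ∑ j, h j * (z j : ℤ)
      then ENNReal.ofReal (korobovCoeff γ α h) else 0)) ^ p
      ≤ ∑ u : Finset (Fin s), ENNReal.ofReal (γ u ^ p)
          * (∑' k, gcdWeight n (α * p) k) ^ u.card := by
  calc _ ≤ (cbcCandidates n).card * ∑ d, lastSum n γ α d z ^ p := by
        gcongr
        exact (ENNReal.rpow_le_rpow (dualSum_le_sum_lastSum n γ α z) hp0.le).trans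
          (ENNReal.rpow_finsetSum_le _ _ hp0 hp1)
    _ ≤ ∑ d, ∑ u : Finset (Fin s),
          (if d ∈ u ∧ ∀ j, d < j → j ∉ u then ENNReal.ofReal (γ u ^ p) else 0)
          * (∑' k, gcdWeight n (α * p) k) ^ u.card := by
        rw [Finset.mul_sum]
        exact Finset.sum_le_sum fun d _ => card_mul_lastSum_rpow_le hγ hα hp0 hp1 hαp hn hz d
    _ ≤ _ := by
        rw [Finset.sum_comm]
        refine Finset.sum_le_sum fun u _ => ?_
        rw [← Finset.sum_mul]
        gcongr
        rcases u.eq_empty_or_nonempty with rfl | hu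
        · simp
        · rw [Finset.sum_eq_single (u.max' hu)]
          · split_ifs <;> simp
          · intro d _ hd
            rw [if_neg]
            rintro ⟨hdu, hmax⟩
            exact hmax _ (lt_of_le_of_ne (u.le_max' d hdu) hd) (u.max'_mem hu)
          · simp

end CBC

/-! ### Existence of CBC vectors and the number of candidates. -/

section CBCExistence

variable {s : ℕ}

/-- The frequencies in the error at d vanish at t, so later greedy choices cannot spoil the
minimality of earlier ones. -/
lemma cbcError_update_of_lt (n : ℕ) (γ : Finset (Fin s) → ℝ) (α : ℕ) {d t : Fin s} (hdt : d < t)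
    (z : Fin s → ℕ) (w : ℕ) :
    cbcError n γ α d (Function.update z t w) = cbcError n γ α d z := by
  have key : ∀ h : Fin s → ℤ, (∀ j, d < j → h j = 0) →
      ∑ j, h j * ((Function.update z t w j : ℕ) : ℤ) = ∑ j, h j * (z j : ℤ) := by
    intro h hh
    refine Finset.sum_congr rfl fun j _ => ?_
    rcases eq_or_ne j t with rfl | hj
    · simp [hh j hdt]
    · rw [Function.update_of_ne hj]
  have hset : (fun h : Fin s → ℤ => h ≠ 0 ∧ (∀ j, d < j → h j = 0) ∧
      (n : ℤ) ∣ ∑ j, h j * ((Function.update z t w j : ℕ) : ℤ))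
      = fun h : Fin s → ℤ => h ≠ 0 ∧ (∀ j, d < j → h j = 0) ∧
      (n : ℤ) ∣ ∑ j, h j * (z j : ℤ) := by
    funext h
    refine propext (and_congr_right fun _ => and_congr_right fun hh => ?_)
    rw [key h hh]
  exact congrArg (fun P : (Fin s → ℤ) → Prop => ∑' h : {h // P h}, korobovCoeff γ α h.1) hset

lemma cbcCandidates_nonempty {n : ℕ} (hn : 0 < n) : (cbcCandidates n).Nonempty :=
  ⟨1, Finset.mem_filter.2 ⟨Finset.mem_Icc.2 ⟨le_rfl, hn⟩, Nat.coprime_one_left n⟩⟩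

/-- The component-by-component algorithm always produces a generating vector. -/
lemma exists_isCBCVector {n : ℕ} (hn : 0 < n) (γ : Finset (Fin s) → ℝ) (α : ℕ) :
    ∃ z : Fin s → ℕ, IsCBCVector n γ α z := by
  suffices H : ∀ t ≤ s, ∃ z : Fin s → ℕ, ∀ d : Fin s, d.val < t → z d ∈ cbcCandidates n ∧
      ∀ w ∈ cbcCandidates n, cbcError n γ α d z ≤ cbcError n γ α d (Function.update z d w) by
    obtain ⟨z, hz⟩ := H s le_rfl
    exact ⟨z, fun d => hz d d.isLt⟩
  intro t
  induction t with
  | zero => exact fun _ => ⟨0, fun d hd => absurd hd (Nat.not_lt_zero _)⟩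
  | succ t ih =>
    intro ht
    obtain ⟨z, hz⟩ := ih (by omega)
    let e : Fin s := ⟨t, ht⟩
    obtain ⟨w, hw, hmin⟩ := (cbcCandidates n).exists_min_image
      (fun w => cbcError n γ α e (Function.update z e w)) (cbcCandidates_nonempty hn)
    refine ⟨Function.update z e w, fun d hd => ?_⟩
    rcases eq_or_ne d e with rfl | hde
    · refine ⟨by rwa [Function.update_self], fun w' hw' => ?_⟩
      rw [Function.update_idem]
      exact hmin w' hw'
    · have hlt : d.val < t := lt_of_le_of_ne (Nat.lt_succ_iff.1 hd) fun h => hde (Fin.ext h)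
      have hlt' : d < e := hlt
      refine ⟨by rw [Function.update_of_ne hde]; exact (hz d hlt).1, fun w' hw' => ?_⟩
      rw [Function.update_comm hde.symm, cbcError_update_of_lt n γ α hlt',
        cbcError_update_of_lt n γ α hlt']
      exact (hz d hlt).2 w' hw'

lemma two_pow_le_card_cbcCandidates (m : ℕ) : 2 ^ m ≤ 2 * (cbcCandidates (2 ^ m)).card := by
  cases m with
  | zero => have := (cbcCandidates_nonempty one_pos).card_pos; simp only [pow_zero]; omega
  | succ m =>
    have h : (Finset.range (2 ^ m)).card ≤ (cbcCandidates (2 ^ (m + 1))).card := by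
      refine Finset.card_le_card_of_injOn (fun i => 2 * i + 1) (fun i hi => ?_)
        (fun i _ j _ hij => by simp only at hij; omega)
      have hi' : i < 2 ^ m := by simpa using hi
      have hle : 2 * i + 1 ≤ 2 ^ (m + 1) := by rw [pow_succ]; omega
      exact Finset.mem_coe.2 (Finset.mem_filter.2 ⟨Finset.mem_Icc.2 ⟨Nat.le_add_left 1 _, hle⟩,
        Nat.Coprime.pow_right _ (by simp)⟩)
    rw [Finset.card_range] at h
    calc 2 ^ (m + 1) = 2 * 2 ^ m := pow_succ' 2 m
      _ ≤ _ := Nat.mul_le_mul_left 2 h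

end CBCExistence

/-! ### Dimension-independent bounds for sums of powers of SPOD weights. -/

section WeightSum

variable {s : ℕ}

lemma Real.rpow_finsetSum_le {ι : Type*} (t : Finset ι) {a : ι → ℝ} (ha : ∀ i ∈ t, 0 ≤ a i) {p : ℝ}
    (hp0 : 0 < p) (hp1 : p ≤ 1) : (∑ i ∈ t, a i) ^ p ≤ ∑ i ∈ t, a i ^ p := by
  have h := ENNReal.rpow_finsetSum_le t (fun i => ENNReal.ofReal (a i)) hp0 hp1
  rw [← ENNReal.ofReal_sum_of_nonneg ha,
    ENNReal.ofReal_rpow_of_nonneg (Finset.sum_nonneg ha) hp0.le,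
    Finset.sum_congr rfl (fun i hi => ENNReal.ofReal_rpow_of_nonneg (ha i hi) hp0.le),
    ← ENNReal.ofReal_sum_of_nonneg (fun i hi => Real.rpow_nonneg (ha i hi) p)] at h
  exact (ENNReal.ofReal_le_ofReal_iff
    (Finset.sum_nonneg fun i hi => Real.rpow_nonneg (ha i hi) p)).1 h

lemma summable_factorial_rpow_mul_pow {t : ℝ} (ht : t < 0) (y : ℝ) (hy : 0 < y) :
    Summable fun l : ℕ => (l.factorial : ℝ) ^ t * y ^ l := by
  refine summable_of_ratio_test_tendsto_lt_one (l := 0) one_pos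
    (Filter.Eventually.of_forall fun l => by positivity) ?_
  have h : Filter.Tendsto (fun l : ℕ => ((l + 1 : ℕ) : ℝ) ^ t * y) Filter.atTop (nhds 0) := by
    have h0 : Filter.Tendsto (fun l : ℕ => ((l + 1 : ℕ) : ℝ) ^ t) Filter.atTop (nhds 0) := by
      have := (tendsto_rpow_neg_atTop (neg_pos.2 ht)).comp
        (tendsto_natCast_atTop_atTop.comp (Filter.tendsto_add_atTop_nat 1))
      simpa [Function.comp_def] using this
    simpa using h0.mul_const y
  refine h.congr fun l => ?_
  rw [Real.norm_of_nonneg (by positivity), Real.norm_of_nonneg (by positivity),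
    Nat.factorial_succ, Nat.cast_mul, Real.mul_rpow (by positivity) (by positivity), pow_succ]
  have h1 : (l.factorial : ℝ) ^ t ≠ 0 := by positivity
  have h2 : y ^ l ≠ 0 := by positivity
  field_simp

/-- Here |m|! is ∏ m_j! times the multinomial coefficient, and m_j! ≤ (α!)^{m_j} as m_j ≤ α. This
loses only a geometric factor in |m|. -/
lemma factorial_sum_le_multinomial {α : ℕ} {m : Fin s → ℕ} (hm : ∀ j, m j ≤ α) :
    (∑ j, m j).factorial ≤ α.factorial ^ (∑ j, m j) * Nat.multinomial Finset.univ m := by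
  rw [← Nat.multinomial_spec]
  refine Nat.mul_le_mul_right _ ?_
  rw [← Finset.prod_pow_eq_pow_sum]
  refine Finset.prod_le_prod' fun j _ => ?_
  rcases Nat.eq_zero_or_pos (m j) with h | h
  · simp [h]
  · exact (Nat.factorial_le (hm j)).trans (Nat.le_self_pow h.ne' _)

/-- Sums over bounded multi-indices of Gevrey-type terms are bounded independently of the
dimension. -/
lemma sum_factorial_rpow_mul_prod_le {t : ℝ} (ht : t < 1) (α : ℕ) {x : Fin s → ℝ}
    (hx : ∀ j, 0 ≤ x j) {X : ℝ} (hX0 : 0 < X) (hX : ∑ j, x j ≤ X) :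
    ∑ m ∈ multiBox (fun _ : Fin s => α), ((∑ j, m j).factorial : ℝ) ^ t * ∏ j, x j ^ m j
      ≤ ∑' l : ℕ, (l.factorial : ℝ) ^ (t - 1) * (α.factorial * X) ^ l := by
  have hsum := summable_factorial_rpow_mul_pow (t := t - 1) (by linarith)
    ((α.factorial : ℝ) * X) (by positivity)
  set R := (multiBox (fun _ : Fin s => α)).image (fun m => ∑ j, m j) with hR
  calc _ = ∑ l ∈ R, ∑ m ∈ (multiBox (fun _ : Fin s => α)) with ∑ j, m j = l,
        ((∑ j, m j).factorial : ℝ) ^ t * ∏ j, x j ^ m j :=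
      (Finset.sum_fiberwise_of_maps_to (fun m hm => Finset.mem_image_of_mem _ hm) _).symm
    _ ≤ ∑ l ∈ R, (l.factorial : ℝ) ^ (t - 1) * (α.factorial * X) ^ l := by
      refine Finset.sum_le_sum fun l _ => ?_
      calc _ ≤ ∑ m ∈ (multiBox (fun _ : Fin s => α)) with ∑ j, m j = l,
            (l.factorial : ℝ) ^ (t - 1) * (α.factorial : ℝ) ^ l
              * (Nat.multinomial Finset.univ m * ∏ j, x j ^ m j) := by
            refine Finset.sum_le_sum fun m hm => ?_
            obtain ⟨hm1, rfl⟩ := Finset.mem_filter.1 hm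
            have h1 := factorial_sum_le_multinomial (mem_multiBox.1 hm1)
            have h1' : ((∑ j, m j).factorial : ℝ)
                ≤ (α.factorial : ℝ) ^ (∑ j, m j) * Nat.multinomial Finset.univ m := by
              exact_mod_cast h1
            -- One full factorial is traded for a multinomial coefficient, so that the multinomial
            -- theorem applies. The leftover power t - 1 < 0 makes the series over l = |m| converge
            -- for every X.
            have h2 : ((∑ j, m j).factorial : ℝ) ^ t
                = ((∑ j, m j).factorial : ℝ) ^ (t - 1) * (∑ j, m j).factorial := by
              rw [← Real.rpow_add_one (by positivity), sub_add_cancel]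
            have h3 : 0 ≤ ∏ j, x j ^ m j := Finset.prod_nonneg fun j _ => pow_nonneg (hx j) _
            rw [h2]
            calc _ ≤ ((∑ j, m j).factorial : ℝ) ^ (t - 1)
                  * ((α.factorial : ℝ) ^ (∑ j, m j) * Nat.multinomial Finset.univ m)
                  * ∏ j, x j ^ m j := by gcongr
              _ = _ := by ring
        _ ≤ (l.factorial : ℝ) ^ (t - 1) * (α.factorial : ℝ) ^ l * (∑ j, x j) ^ l := by
            rw [← Finset.mul_sum, Finset.sum_pow_eq_sum_piAntidiag]
            refine mul_le_mul_of_nonneg_left ?_ (by positivity)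
            refine Finset.sum_le_sum_of_subset_of_nonneg (fun m hm => ?_) fun m _ _ =>
              mul_nonneg (Nat.cast_nonneg _) (Finset.prod_nonneg fun j _ => pow_nonneg (hx j) _)
            simpa using (Finset.mem_filter.1 hm).2
        _ ≤ _ := by
            rw [mul_pow, ← mul_assoc]
            have := Finset.sum_nonneg fun j (_ : j ∈ Finset.univ) => hx j
            gcongr
    _ ≤ _ := hsum.sum_le_tsum _ fun l _ => by positivity

lemma spodWeight_nonneg {C β μ : ℝ} (hC : 0 ≤ C) (hμ : 0 < μ) {b : ℕ → ℝ} (hb : ∀ j, 0 ≤ b j)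
    (α : ℕ) (u : Finset (Fin s)) : 0 ≤ spodWeight C β μ b α u := by
  refine Finset.sum_nonneg fun m _ => ?_
  have : 0 ≤ ∏ j : u, (b (j : Fin s) ^ m j * (Nat.stirlingSecond α (m j) : ℝ)) :=
    Finset.prod_nonneg fun j _ => mul_nonneg (pow_nonneg (hb _) _) (Nat.cast_nonneg _)
  positivity

/-- The summands of the `p`-th power of a weight are dominated by Gevrey-type terms. -/
lemma spodWeight_term_rpow_le {C β μ p c : ℝ} (hC : 1 ≤ C) (hβ : 1 ≤ β) (hμ0 : 0 < μ)
    (hp0 : 0 < p) (hc : 1 ≤ c) {b : ℕ → ℝ} (hb : ∀ j, 0 ≤ b j) {α : ℕ}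
    (hα : 1 ≤ α) (u : Finset (Fin s)) {m : Fin s → ℕ}
    (hm : m ∈ multiBox (fun j => if j ∈ u then α else 0)) :
    ((∏ j : Fin s, (((if j ∈ u then α else 0 : ℕ).stirlingSecond (m j) : ℕ) : ℝ))
      * (C ^ (∑ j, m j) * (2 : ℝ) ^ (β * (((∑ j, m j : ℕ) : ℝ) - 1))
        * μ ^ (-(((∑ j, m j : ℕ) : ℝ) / 2)) * ((∑ j, m j).factorial : ℝ) ^ β
        * ∏ j : Fin s, b (j : ℕ) ^ m j)) ^ p * c ^ u.card
    ≤ if Finset.univ.filter (fun j : Fin s => m j ≠ 0) = u then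
        ((∑ j, m j).factorial : ℝ) ^ (β * p)
          * ∏ j : Fin s, (c * ((∑ i ∈ Finset.range (α + 1), (α.stirlingSecond i : ℝ))
            * (C * 2 ^ β * μ ^ (-(1 / 2) : ℝ))) ^ p * b (j : ℕ) ^ p) ^ m j
      else 0 := by
  set ν : Fin s → ℕ := fun j => if j ∈ u then α else 0 with hν
  rw [mem_multiBox] at hm
  have hcμ : 0 < C * 2 ^ β * μ ^ (-(1 / 2) : ℝ) := by positivity
  set B : ℝ := ∑ i ∈ Finset.range (α + 1), (α.stirlingSecond i : ℝ) with hB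
  have hBle : ∀ i ≤ α, (α.stirlingSecond i : ℝ) ≤ B := fun i hi =>
    Finset.single_le_sum (f := fun i => (α.stirlingSecond i : ℝ)) (fun _ _ => Nat.cast_nonneg _)
      (Finset.mem_range.2 (Nat.lt_succ_of_le hi))
  have hB1 : 1 ≤ B := by simpa [Nat.stirlingSecond_self] using hBle α le_rfl
  have hbm : 0 ≤ ∏ j : Fin s, b (j : ℕ) ^ m j := Finset.prod_nonneg fun j _ => pow_nonneg (hb _) _
  by_cases hz : ∃ j ∈ u, m j = 0
  · obtain ⟨j, hj, hmj⟩ := hz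
    have h0 : ∏ j : Fin s, (((ν j).stirlingSecond (m j) : ℕ) : ℝ) = 0 := by
      refine Finset.prod_eq_zero (Finset.mem_univ j) ?_
      obtain ⟨a, rfl⟩ := Nat.exists_eq_add_of_le' hα
      simp [hν, hj, hmj]
    rw [h0, zero_mul, Real.zero_rpow hp0.ne', zero_mul]
    split_ifs
    · exact mul_nonneg (by positivity) (Finset.prod_nonneg fun j _ =>
        pow_nonneg (mul_nonneg (by positivity) (Real.rpow_nonneg (hb _) _)) _)
    · exact le_rfl
  · push Not at hz
    have hsupp : Finset.univ.filter (fun j : Fin s => m j ≠ 0) = u := by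
      ext j
      simp only [Finset.mem_filter, Finset.mem_univ, true_and]
      refine ⟨fun h => ?_, fun h => hz j h⟩
      by_contra hj
      have := hm j
      simp only [hν, hj, if_false] at this
      omega
    rw [if_pos hsupp]
    -- As m is nonzero on u, c^{|u|} ≤ c^{|m|}, and c can be absorbed into the base attached to each
    -- variable. The same device bounds the Stirling factors by B^{|m|}.
    have hcard : u.card ≤ ∑ j, m j := by
      rw [Finset.card_eq_sum_ones]
      exact (Finset.sum_le_sum fun j hj => Nat.one_le_iff_ne_zero.2 (hz j hj)).trans
        (Finset.sum_le_univ_sum_of_nonneg fun _ => Nat.zero_le _)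
    have hS : ∏ j : Fin s, (((ν j).stirlingSecond (m j) : ℕ) : ℝ) ≤ B ^ (∑ j, m j) := by
      rw [← Finset.prod_pow_eq_pow_sum]
      refine Finset.prod_le_prod (fun _ _ => Nat.cast_nonneg _) fun j _ => ?_
      by_cases hj : j ∈ u
      · have hmj := hm j
        simp only [hν, hj, if_true] at hmj ⊢
        exact (hBle _ hmj).trans (le_self_pow₀ hB1 (hz j hj))
      · have hmj := hm j
        simp only [hν, hj, if_false, Nat.le_zero] at hmj
        simp [hν, hj, hmj]
    have h2 : (2 : ℝ) ^ (β * (((∑ j, m j : ℕ) : ℝ) - 1)) ≤ ((2 : ℝ) ^ β) ^ (∑ j, m j) := by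
      rw [← Real.rpow_natCast, ← Real.rpow_mul two_pos.le]
      exact Real.rpow_le_rpow_of_exponent_le one_le_two (by nlinarith)
    have h3 : μ ^ (-(((∑ j, m j : ℕ) : ℝ) / 2)) = (μ ^ (-(1 / 2) : ℝ)) ^ (∑ j, m j) := by
      rw [← Real.rpow_natCast, ← Real.rpow_mul hμ0.le]
      congr 1; ring
    set N := ∑ j, m j with hN
    set A : ℝ := B * (C * 2 ^ β * μ ^ (-(1 / 2) : ℝ)) with hA
    have hA0 : 0 ≤ A := by positivity
    have hterm : (∏ j : Fin s, (((ν j).stirlingSecond (m j) : ℕ) : ℝ))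
        * (C ^ N * (2 : ℝ) ^ (β * ((N : ℝ) - 1)) * μ ^ (-((N : ℝ) / 2)) * (N.factorial : ℝ) ^ β
          * ∏ j : Fin s, b (j : ℕ) ^ m j)
        ≤ A ^ N * (N.factorial : ℝ) ^ β * ∏ j : Fin s, b (j : ℕ) ^ m j := by
      rw [h3]
      calc _ ≤ B ^ N * (C ^ N * ((2 : ℝ) ^ β) ^ N * (μ ^ (-(1 / 2) : ℝ)) ^ N
            * (N.factorial : ℝ) ^ β * ∏ j : Fin s, b (j : ℕ) ^ m j) := by gcongr
        _ = _ := by rw [hA]; simp only [mul_pow]; ring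
    have hprod : ∏ j : Fin s, (c * A ^ p * b (j : ℕ) ^ p) ^ m j
        = c ^ N * (A ^ N) ^ p * (∏ j : Fin s, b (j : ℕ) ^ m j) ^ p := by
      simp only [mul_pow]
      rw [Finset.prod_mul_distrib, Finset.prod_mul_distrib, Finset.prod_pow_eq_pow_sum,
        Finset.prod_pow_eq_pow_sum, ← Real.finsetProd_rpow _ _ fun j _ => pow_nonneg (hb _) _,
        Real.rpow_pow_comm hA0]
      congr 1
      exact Finset.prod_congr rfl fun j _ => Real.rpow_pow_comm (hb _) _ _
    rw [hprod]
    calc _ ≤ (A ^ N * (N.factorial : ℝ) ^ β * ∏ j : Fin s, b (j : ℕ) ^ m j) ^ p * c ^ N := by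
          refine mul_le_mul (Real.rpow_le_rpow ?_ hterm hp0.le) (pow_le_pow_right₀ hc hcard)
            (by positivity) (by positivity)
          have : 0 ≤ ∏ j : Fin s, (((ν j).stirlingSecond (m j) : ℕ) : ℝ) :=
            Finset.prod_nonneg fun _ _ => Nat.cast_nonneg _
          positivity
      _ = _ := by
          rw [Real.mul_rpow (by positivity) hbm, Real.mul_rpow (by positivity) (by positivity),
            ← Real.rpow_mul (by positivity)]
          ring

lemma exists_bound_sum_spodWeight_rpow {C β μ p c : ℝ} (hC : 1 ≤ C) (hβ : 1 ≤ β) (hμ0 : 0 < μ)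
    (hp0 : 0 < p) (hp1 : p ≤ 1) (hpβ : β * p < 1) (hc : 1 ≤ c) {b : ℕ → ℝ}
    (hb : ∀ j, 0 ≤ b j) (hbs : Summable fun j => b j ^ p) {α : ℕ} (hα : 1 ≤ α) :
    ∃ M : ℝ, 0 ≤ M ∧ ∀ s : ℕ,
      ∑ u : Finset (Fin s), spodWeight C β μ b α u ^ p * c ^ u.card ≤ M := by
  set A : ℝ := c * ((∑ i ∈ Finset.range (α + 1), (α.stirlingSecond i : ℝ))
            * (C * 2 ^ β * μ ^ (-(1 / 2) : ℝ))) ^ p with hA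
  have hA0 : 0 ≤ A := by positivity
  -- The added 1 keeps X positive even when b = 0.
  set X : ℝ := A * ∑' j, b j ^ p + 1 with hX
  have hbp : ∀ j, 0 ≤ b j ^ p := fun j => Real.rpow_nonneg (hb j) p
  have hX0 : 0 < X := by
    have h : 0 ≤ ∑' j, b j ^ p := tsum_nonneg hbp
    positivity
  refine ⟨∑' l : ℕ, (l.factorial : ℝ) ^ (β * p - 1) * (α.factorial * X) ^ l,
    tsum_nonneg fun l => by positivity, fun s => ?_⟩
  have hle : ∑ j : Fin s, A * b (j : ℕ) ^ p ≤ X := by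
    rw [← Finset.mul_sum, Fin.sum_univ_eq_sum_range (fun j => b j ^ p)]
    have := mul_le_mul_of_nonneg_left (hbs.sum_le_tsum (Finset.range s) fun j _ => hbp j) hA0
    linarith
  refine le_trans ?_ (sum_factorial_rpow_mul_prod_le hpβ α
    (fun j : Fin s => mul_nonneg hA0 (hbp j)) hX0 hle)
  have hF : ∀ m : Fin s → ℕ, 0 ≤ ((∑ j, m j).factorial : ℝ) ^ (β * p)
      * ∏ j : Fin s, (A * b (j : ℕ) ^ p) ^ m j := fun m =>
    mul_nonneg (by positivity)
      (Finset.prod_nonneg fun j _ => pow_nonneg (mul_nonneg hA0 (hbp j)) _)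
  calc _ ≤ ∑ u : Finset (Fin s), ∑ m ∈ multiBox (fun _ : Fin s => α),
        (if Finset.univ.filter (fun j : Fin s => m j ≠ 0) = u then
        ((∑ j, m j).factorial : ℝ) ^ (β * p) * ∏ j : Fin s, (A * b (j : ℕ) ^ p) ^ m j
        else 0) := by
        refine Finset.sum_le_sum fun u _ => ?_
        rw [← sum_multiBox_eq_spodWeight C β μ b hα u]
        refine (mul_le_mul_of_nonneg_right (Real.rpow_finsetSum_le _ (fun m _ => ?_) hp0 hp1)
          (by positivity)).trans ?_
        · have h1 : 0 ≤ ∏ j : Fin s, b (j : ℕ) ^ m j := Finset.prod_nonneg fun j _ => pow_nonneg (hb _) _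
          positivity
        rw [Finset.sum_mul]
        refine (Finset.sum_le_sum fun m hm =>
          spodWeight_term_rpow_le hC hβ hμ0 hp0 hc hb hα u hm).trans ?_
        refine Finset.sum_le_sum_of_subset_of_nonneg (fun m hm => ?_) fun m _ _ => ?_
        · rw [mem_multiBox] at hm ⊢
          intro j
          refine (hm j).trans ?_
          split_ifs <;> omega
        · split_ifs
          exacts [hF m, le_rfl]
    _ = _ := by
      -- Each m meets exactly one u, namely its own support, so the double sum collapses to a sum
      -- over m.
      rw [Finset.sum_comm]
      exact Finset.sum_congr rfl fun m _ => by simp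

end WeightSum

/-! ### The worst-case error of CBC rules and the final estimate. -/

section ErrorBound

open scoped ENNReal

/-- The lattice rule error for a function with the given Fourier decay, for a rule constructed
component by component. -/
lemma exists_bound_dualSum {p : ℝ} (hp0 : 0 < p) (hp1 : p ≤ 1) {α : ℕ} (hα : 2 ≤ α)
    (hαp : 1 < α * p) {C β μ : ℝ} (hC : 1 ≤ C) (hβ : 1 ≤ β) (hμ0 : 0 < μ) (hpβ : β * p < 1)
    {b : ℕ → ℝ} (hb : ∀ j, 0 ≤ b j) (hbs : Summable fun j => b j ^ p) :
    ∃ M : ℝ, 0 ≤ M ∧ ∀ (s m : ℕ) (z : Fin s → ℕ),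
      IsCBCVector (2 ^ m) (spodWeight C β μ b α) α z →
      ∑' h : {h : Fin s → ℤ // h ≠ 0 ∧ ((2 ^ m : ℕ) : ℤ) ∣ ∑ j, h j * (z j : ℤ)},
        korobovCoeff (spodWeight C β μ b α) α h.1 ≤ M * ((2 ^ m : ℕ) : ℝ) ^ (-(1 / p)) := by
  classical
  obtain ⟨c, hc1, hc⟩ := exists_bound_tsum_gcd hαp
  obtain ⟨M, hM0, hM⟩ := exists_bound_sum_spodWeight_rpow hC hβ hμ0 hp0 hp1 hpβ hc1 hb hbs
    (one_le_two.trans hα)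
  -- The 2 reflects that at least half of the residues modulo 2^m are candidates: n E^p ≤ 2 ·
  -- #candidates · E^p ≤ 2M.
  refine ⟨(2 * M) ^ (1 / p), by positivity, fun s m z hz => ?_⟩
  have hγ : ∀ u : Finset (Fin s), 0 ≤ spodWeight C β μ b α u :=
    spodWeight_nonneg (zero_le_one.trans hC) hμ0 hb α
  set γ : Finset (Fin s) → ℝ := spodWeight C β μ b α with hγdef
  set n : ℕ := 2 ^ m with hn
  have hn0 : 0 < n := by positivity
  set S : Set (Fin s → ℤ) := {h | h ≠ 0 ∧ (n : ℤ) ∣ ∑ j, h j * (z j : ℤ)} with hS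
  set E : ℝ := ∑' h : S, korobovCoeff γ α h.1 with hE
  have hE0 : 0 ≤ E := tsum_nonneg fun h => korobovCoeff_nonneg hγ α h.1
  have hEeq : ENNReal.ofReal E = ∑' h : Fin s → ℤ,
      (if h ≠ 0 ∧ (n : ℤ) ∣ ∑ j, h j * (z j : ℤ)
        then ENNReal.ofReal (korobovCoeff γ α h) else 0) := by
    rw [hE, ENNReal.ofReal_tsum_of_nonneg (fun h : S => korobovCoeff_nonneg hγ α h.1)
      ((summable_korobovCoeff hγ hα).subtype _),
      tsum_subtype S (fun h => ENNReal.ofReal (korobovCoeff γ α h))]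
    exact tsum_congr fun h => by rw [Set.indicator_apply]; exact if_congr Iff.rfl rfl rfl
  have hkey : ((cbcCandidates n).card : ℝ≥0∞) * ENNReal.ofReal E ^ p ≤ ENNReal.ofReal M := by
    rw [hEeq]
    refine le_trans ?_ (ENNReal.ofReal_le_ofReal (hM s))
    rw [ENNReal.ofReal_sum_of_nonneg fun u _ => by have := hγ u; positivity]
    refine le_trans ?_ (Finset.sum_le_sum (f := fun u : Finset (Fin s) =>
      ENNReal.ofReal (γ u ^ p) * (∑' k, gcdWeight n (α * p) k) ^ u.card) fun u _ => ?_)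
    · refine le_trans (le_of_eq ?_) (card_mul_dualSum_rpow_le hγ hα hp0 hp1 hαp hn0 hz)
      congr!
    · rw [ENNReal.ofReal_mul (Real.rpow_nonneg (hγ u) p), ENNReal.ofReal_pow (by linarith)]
      gcongr
      exact hc m
  have hreal : ((cbcCandidates n).card : ℝ) * E ^ p ≤ M := by
    rw [ENNReal.ofReal_rpow_of_nonneg hE0 hp0.le, ← ENNReal.ofReal_natCast,
      ← ENNReal.ofReal_mul (Nat.cast_nonneg _)] at hkey
    exact (ENNReal.ofReal_le_ofReal_iff hM0).1 hkey
  have hcard : (n : ℝ) ≤ 2 * ((cbcCandidates n).card : ℝ) := by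
    exact_mod_cast two_pow_le_card_cbcCandidates m
  have hnR : (0 : ℝ) < n := by exact_mod_cast hn0
  have hEp : E ^ p ≤ 2 * M / n := by
    rw [le_div_iff₀ hnR]
    have : 0 ≤ E ^ p := Real.rpow_nonneg hE0 p
    nlinarith
  calc E = (E ^ p) ^ (1 / p) := by
        rw [← Real.rpow_mul hE0, mul_one_div_cancel hp0.ne', Real.rpow_one]
    _ ≤ (2 * M / n) ^ (1 / p) := by gcongr
    _ = _ := by
        rw [Real.div_rpow (by positivity) hnR.le, Real.rpow_neg hnR.le, div_eq_mul_inv]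

end ErrorBound

theorem mainTheorem10
    {k : ℕ} {Ξ : Type*}
    (Γ : Matrix (Fin k) (Fin k) ℝ) (hΓ : Γ.PosDef)
    (μ : ℝ) (hμ0 : 0 < μ) (hμ1 : μ ≤ 1) (hμ : ∀ i, μ ≤ hΓ.1.eigenvalues i)
    (C β p : ℝ) (hC : 1 ≤ C) (hβ : 1 ≤ β) (hp0 : 0 < p) (hp1 : p < 1) (hpβ : p < 1 / β)
    (b : ℕ → ℝ) (hb0 : ∀ j, 0 ≤ b j) (hb : Memℓp b (ENNReal.ofReal p))
    (G : (s : ℕ) → (Fin s → ℝ) → Ξ → EuclideanSpace ℝ (Fin k))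
    (hG : ParametricRegularity G C β b)
    (α : ℕ) (hα : α = ⌊1 / p⌋₊ + 1) :
    ∃ K : ℝ, 0 < K ∧ ∀ s : ℕ, 1 ≤ s → ∀ m : ℕ,
      (∃ z : Fin s → ℕ, IsCBCVector (2 ^ m) (spodWeight C β μ b α) α z) ∧
      ∀ z : Fin s → ℕ, IsCBCVector (2 ^ m) (spodWeight C β μ b α) α z →
        ∀ (ξ : Ξ) (y : EuclideanSpace ℝ (Fin k)),
          |(∫ θ in Theta s, fPer Γ (fun θ' => G s θ' ξ) y θ)
              - latticeRule (2 ^ m) z (fPer Γ (fun θ' => G s θ' ξ) y)|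
            ≤ K * ((2 ^ m : ℕ) : ℝ) ^ (-(1 / p)) := by
  have hα2 : 2 ≤ α := by
    have : 1 ≤ ⌊1 / p⌋₊ := Nat.one_le_floor_iff _ |>.2 (by rw [le_div_iff₀ hp0]; linarith)
    omega
  -- The choice α = ⌊1/p⌋ + 1 is the smallest integer with αp > 1.
  have hαp : 1 < α * p := by
    have := Nat.lt_floor_add_one (1 / p)
    rw [div_lt_iff₀ hp0] at this
    rw [hα]; push_cast; exact this
  have hβp : β * p < 1 := by rwa [lt_div_iff₀ (by linarith), mul_comm] at hpβ
  have hbs : Summable fun j => b j ^ p := by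
    rw [memℓp_gen_iff (by rwa [ENNReal.toReal_ofReal hp0.le]), ENNReal.toReal_ofReal hp0.le] at hb
    exact hb.congr fun j => by rw [Real.norm_of_nonneg (hb0 j)]
  obtain ⟨M, hM0, hM⟩ := exists_bound_dualSum hp0 hp1.le hα2 hαp hC hβ hμ0 hβp hb0 hbs
  set K : ℝ := gaussConst Γ * Real.exp 7 * 2 ^ β with hK
  have hK0 : 0 ≤ K := by have := gaussConst_nonneg Γ; positivity
  -- The added 1 serves only to make the constant strictly positive.
  refine ⟨K * M + 1, by positivity, fun s hs m =>
    ⟨exists_isCBCVector (by positivity) _ _, fun z hz ξ y => ?_⟩⟩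
  obtain ⟨D, hD0, hD, hc, hp, hDb⟩ := exists_periodic_derivatives hΓ hμ0 hμ1 hμ hC hβ hb0
    (hG s hs ξ).1 (hG s hs ξ).2 y (one_le_two.trans hα2)
  have hγ : ∀ u : Finset (Fin s), 0 ≤ spodWeight C β μ b α u :=
    spodWeight_nonneg (zero_le_one.trans hC) hμ0 hb0 α
  rw [← hD0]
  refine (abs_integral_sub_latticeRule_le (hc 0) (hp 0)
    ((summable_korobovCoeff hγ hα2).mul_left K)
    (norm_torusCoeff_le_korobovCoeff hD hc hp hDb) (by positivity) z).trans ?_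
  rw [tsum_mul_left, add_mul, mul_assoc]
  have h1 := mul_le_mul_of_nonneg_left (hM s m z hz) hK0
  have h2 : (0 : ℝ) ≤ 1 * ((2 ^ m : ℕ) : ℝ) ^ (-(1 / p)) := by positivity
  linarith
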